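/- For $\alpha\ge 1$ let $\mathcal L^\alpha$ be the set of real $q\in L^\alpha(\mathbb R_+)$ with $\operatorname{supp} q\subset[0,1]$. For $q\in\mathcal L^1$ and $k\in\mathbb C$ let $f_+(\cdot,k)$ be the Jost solution, i.e. the solution of $-f''+qf=k^2f$ on $[0,\infty)$ with $f_+(x,k)=e^{ikx}$ for $x\ge1$, and let $\psi(k)=f_+(0,k)$ be the Jost function. Let $\mathcal L^\alpha_+$ be the set of $q\in\mathcal L^\alpha$ such that $\psi(k)\ne0$ whenever $\operatorname{Im}k>0$. The phase shift of $q$ is the odd continuous function $\xi:\mathbb R\setminus\{0\}\to\mathbb R$ with $\psi(-k)/\psi(k)=e^{-2i\xi(k)}$ for $k\ne0$ and $\xi(k)=O(1/k)$ as $k\to\pm\infty$; on $[0,\infty)$ its value at $0$ is taken to be the one-sided limit $\xi(0):=\xi(+0)$. Proposition. Let $q\in\mathcal L^1_+$ and $\sigma_o=\int_0^1q\,dx$. Then the phase shift $\xi$ exists (including the limit $\xi(+0)$) and is unique, and the following hold. (i) The function $k\mapsto k-\xi(k)$ is strictly increasing on $[0,\infty)$; moreover $\xi$ is differentiable on $[0,\infty)$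 (one-sidedly at $0$) and $1-\xi'(k)>0$ for all $k\ge0$. (ii) For each $n\ge1$ the equation $k-\xi(k)=\frac{\pi n}2$ has a unique solution $k=p_n\ge0$. One has $$p_n=\frac{\pi n}2+\xi(p_n),\qquad \xi(p_n)=\frac{\sigma_o+\sigma_n}{\pi n},\qquad n\ge 1,$$ where $\sigma_n\to0$ as $n\to\infty$. (iii) Let $\mu_1<\mu_2<\dots$ be all eigenvalues of the problem $-y''+qy=\lambda y$, $y(0)=y(1)=0$, and let $\tau_1<\tau_2<\dots$ be all eigenvalues of the problem $-y''+qy=\lambda y$, $y(0)=y'(1)=0$, on $[0,1]$. Then $\mu_n=p_{2n}^2$ and $\tau_n=p_{2n-1}^2$ for all $n\ge1$. (iv) If in addition $q\in\mathcal L^2_+$, then $(\sigma_n)_{n\ge1}\in\ell^2$. -/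

import Mathlib

open MeasureTheory Filter Topology Set
open scoped ENNReal NNReal

namespace HalfLine

/-- The class `𝓛^α`: real potentials `q ∈ L^α(ℝ₊)` whose (essential) support is contained in
`[0, 1]`.  The values of `q` on the negative half-line are irrelevant. -/
def PotentialClass (α : ℝ≥0∞) : Set (ℝ → ℝ) :=
  {q | MemLp q α (volume.restrict (Ici 0)) ∧ ∀ᵐ x ∂(volume.restrict (Ioi 1)), q x = 0}

/-- `y` is a solution of `-y'' + q y = l y` on the interval `I` in the Carathéodory sense, with
derivative `y'`: the function `y` is differentiable with derivative `y'`, and `y'` is a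
primitive of the locally integrable function `(q - l) y`, i.e. `y'` is locally absolutely
continuous and `(y')' = (q - l) y` almost everywhere. -/
structure IsSolutionOn (q : ℝ → ℝ) (l : ℂ) (I : Set ℝ) (y y' : ℝ → ℂ) : Prop where
  hasDeriv : ∀ x ∈ I, HasDerivWithinAt y (y' x) I x
  integral_eq : ∀ a ∈ I, ∀ b ∈ I, y' b - y' a = ∫ t in a..b, ((q t : ℂ) - l) * y t

/-- `f` is the Jost solution `f₊(·, k)`: it solves `-f'' + q f = k² f` on `[0, ∞)` and
`f x = exp (i k x)` for `x ≥ 1`. -/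
def IsJostSolution (q : ℝ → ℝ) (k : ℂ) (f : ℝ → ℂ) : Prop :=
  (∃ f' : ℝ → ℂ, IsSolutionOn q (k ^ 2) (Ici 0) f f') ∧
    ∀ x : ℝ, 1 ≤ x → f x = Complex.exp (Complex.I * k * x)

/-! ### Existence and uniqueness of the Jost solution -/

lemma integral_mul_primitive_pow {a : ℝ → ℝ} (ha : IntervalIntegrable a volume 0 1) (n : ℕ)
    {x : ℝ} (hx : x ∈ Icc (0 : ℝ) 1) :
    ∫ t in x..1, a t * (∫ s in t..1, a s) ^ n = (∫ s in x..1, a s) ^ (n + 1) / (n + 1) := by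
  have hsub : uIcc x 1 ⊆ uIcc (0 : ℝ) 1 := by
    rw [uIcc_of_le hx.2, uIcc_of_le zero_le_one]
    exact Icc_subset_Icc_left hx.1
  have hax : IntervalIntegrable a volume x 1 := ha.mono_set hsub
  have hsymm : (fun t => ∫ s in t..1, a s) = -(fun t => ∫ s in (1 : ℝ)..t, a s) := by
    funext t
    simp only [Pi.neg_apply]
    exact intervalIntegral.integral_symm _ _
  have hG : AbsolutelyContinuousOnInterval (fun t => ∫ s in t..1, a s) x 1 := by
    rw [hsymm]
    exact (hax.absolutelyContinuousOnInterval_intervalIntegral (c := 1) (by simp)).neg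
  have hpow : ∀ m : ℕ, AbsolutelyContinuousOnInterval
      (fun t => (∫ s in t..1, a s) ^ (m + 1)) x 1 := by
    intro m
    induction m with
    | zero => simpa using hG
    | succ m ih =>
      have h := ih.mul hG
      have he : (fun t => (∫ s in t..1, a s) ^ (m + 1 + 1)) =
          (fun t => (∫ s in t..1, a s) ^ (m + 1)) * (fun t => ∫ s in t..1, a s) := by
        funext t
        simp only [Pi.mul_apply, pow_succ]
      rw [he]
      exact h
  have hftc := (hpow n).integral_deriv_eq_sub
  have hcongr : ∫ t in x..1, deriv (fun t => (∫ s in t..1, a s) ^ (n + 1)) t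
      = ∫ t in x..1, -((n : ℝ) + 1) * (a t * (∫ s in t..1, a s) ^ n) := by
    apply intervalIntegral.integral_congr_ae
    filter_upwards [hax.ae_hasDerivAt_integral] with t ht htm
    have h1 := ht (uIoc_subset_uIcc htm) 1 (by simp)
    have h2 : HasDerivAt (fun t => ∫ s in t..1, a s) (-a t) t := by
      rw [hsymm]
      exact h1.neg
    have h3 := (h2.fun_pow (n + 1)).deriv
    rw [h3]
    push_cast
    ring
  rw [hcongr, intervalIntegral.integral_const_mul] at hftc
  simp only [intervalIntegral.integral_same] at hftc
  have hn : ((n : ℝ) + 1) ≠ 0 := by positivity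
  rw [eq_div_iff hn]
  have h0 : (0 : ℝ) ^ (n + 1) = 0 := by simp
  rw [h0] at hftc
  linarith

lemma intervalIntegrable_potential_mul {q : ℝ → ℝ} (hq : IntervalIntegrable q volume 0 1) (l : ℂ)
    {y : ℝ → ℂ} (hy : ContinuousOn y (Icc 0 1)) :
    IntervalIntegrable (fun t => ((q t : ℂ) - l) * y t) volume 0 1 := by
  have h0 : IntervalIntegrable (fun t => (q t : ℂ)) volume 0 1 := by
    rw [intervalIntegrable_iff] at hq ⊢
    exact Integrable.ofReal hq
  have h1 : IntervalIntegrable (fun t => (q t : ℂ) - l) volume 0 1 :=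
    h0.sub intervalIntegrable_const
  refine h1.mul_continuousOn ?_
  rwa [uIcc_of_le (zero_le_one' ℝ)]

lemma continuous_primitive_Icc {g : ℝ → ℂ} (hg : IntervalIntegrable g volume 0 1) :
    Continuous fun x : Icc (0 : ℝ) 1 => ∫ t in (1 : ℝ)..x, g t := by
  have h := intervalIntegral.continuousOn_primitive_interval' hg
    (show (1 : ℝ) ∈ uIcc (0 : ℝ) 1 by simp)
  rw [uIcc_of_le (zero_le_one' ℝ)] at h
  exact continuousOn_iff_continuous_domRestrict.mp h

/-- The value at a real number, projected to `[0, 1]`, of a continuous function on `[0, 1]`. -/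
noncomputable def ev (Y : C(Icc (0 : ℝ) 1, ℂ × ℂ)) (t : ℝ) : ℂ × ℂ :=
  Y (projIcc 0 1 zero_le_one t)

lemma ev_of_mem (Y : C(Icc (0 : ℝ) 1, ℂ × ℂ)) {t : ℝ} (ht : t ∈ Icc (0 : ℝ) 1) :
    ev Y t = Y ⟨t, ht⟩ := by
  unfold ev
  rw [projIcc_of_mem _ ht]

lemma continuous_ev (Y : C(Icc (0 : ℝ) 1, ℂ × ℂ)) : Continuous (ev Y) :=
  Y.continuous.comp continuous_projIcc

/-- The Picard operator of the first order system `y' = v`, `v' = (q - l) y` with initial values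
`y 1 = c`, `v 1 = d`. -/
noncomputable def picard {q : ℝ → ℝ} (hq : IntervalIntegrable q volume 0 1) (l c d : ℂ)
    (Y : C(Icc (0 : ℝ) 1, ℂ × ℂ)) : C(Icc (0 : ℝ) 1, ℂ × ℂ) where
  toFun x := (c + ∫ t in (1 : ℝ)..x, (ev Y t).2,
    d + ∫ t in (1 : ℝ)..x, ((q t : ℂ) - l) * (ev Y t).1)
  continuous_toFun :=
    (continuous_const.add (continuous_primitive_Icc
      ((continuous_snd.comp (continuous_ev Y)).intervalIntegrable 0 1))).prodMk
    (continuous_const.add (continuous_primitive_Icc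
      (intervalIntegrable_potential_mul hq l (continuous_fst.comp (continuous_ev Y)).continuousOn)))

lemma norm_picard_iterate_sub_le {q : ℝ → ℝ} (hq : IntervalIntegrable q volume 0 1) (l c d : ℂ)
    (Y Z : C(Icc (0 : ℝ) 1, ℂ × ℂ)) (n : ℕ) : ∀ x ∈ Icc (0 : ℝ) 1,
    ‖ev ((picard hq l c d)^[n] Y) x - ev ((picard hq l c d)^[n] Z) x‖ ≤
      (∫ t in x..1, (1 + |q t| + ‖l‖)) ^ n / n.factorial * dist Y Z := by
  have ha : IntervalIntegrable (fun t => 1 + |q t| + ‖l‖) volume 0 1 :=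
    (intervalIntegrable_const.add hq.abs).add intervalIntegrable_const
  induction n with
  | zero =>
    intro x hx
    simp only [Function.iterate_zero, id_eq, pow_zero, Nat.factorial_zero, Nat.cast_one, div_one,
      one_mul]
    rw [← dist_eq_norm]
    exact ContinuousMap.dist_apply_le_dist _
  | succ n ih =>
    intro x hx
    set U := (picard hq l c d)^[n] Y with hU
    set V := (picard hq l c d)^[n] Z with hV
    rw [Function.iterate_succ_apply', Function.iterate_succ_apply', ← hU, ← hV,
      ev_of_mem _ hx, ev_of_mem _ hx]
    have hsub : uIcc x 1 ⊆ uIcc (0 : ℝ) 1 := by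
      rw [uIcc_of_le hx.2, uIcc_of_le zero_le_one]
      exact Icc_subset_Icc_left hx.1
    have hsub' : uIcc 1 x ⊆ uIcc (0 : ℝ) 1 := by rwa [uIcc_comm]
    set A : ℝ → ℝ := fun t => ∫ s in t..1, (1 + |q s| + ‖l‖) with hA
    have hAc : ContinuousOn A (uIcc 0 1) :=
      intervalIntegral.continuousOn_primitive_interval_left
        (by rw [← intervalIntegrable_iff']; exact ha)
    have hgi : IntervalIntegrable
        (fun t => (1 + |q t| + ‖l‖) * A t ^ n * (dist Y Z / n.factorial)) volume x 1 :=
      (((ha.mul_continuousOn (hAc.pow n))).mul_const _).mono_set hsub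
    have hval : ∫ t in x..1, (1 + |q t| + ‖l‖) * A t ^ n * (dist Y Z / n.factorial)
        = A x ^ (n + 1) / (n + 1).factorial * dist Y Z := by
      rw [intervalIntegral.integral_mul_const, integral_mul_primitive_pow ha n hx,
        Nat.factorial_succ]
      push_cast
      have : (n.factorial : ℝ) ≠ 0 := by exact_mod_cast n.factorial_ne_zero
      have : ((n : ℝ) + 1) ≠ 0 := by positivity
      simp only [hA]
      field_simp
    have key : ∀ t ∈ Ioc x 1, ‖ev U t - ev V t‖ ≤ A t ^ n * (dist Y Z / n.factorial) := by
      intro t ht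
      have := ih t ⟨hx.1.trans ht.1.le, ht.2⟩
      calc _ ≤ _ := this
        _ = _ := by simp only [hA]; ring
    have hnn : ∀ t ∈ Ioc x 1, 0 ≤ A t ^ n * (dist Y Z / n.factorial) :=
      fun t ht => (norm_nonneg _).trans (key t ht)
    have comp : ∀ (g : ℝ → ℂ),
        (∀ t ∈ Ioc x 1, ‖g t‖ ≤ (1 + |q t| + ‖l‖) * ‖ev U t - ev V t‖) →
        ‖∫ t in (1 : ℝ)..x, g t‖ ≤ A x ^ (n + 1) / (n + 1).factorial * dist Y Z := by
      intro g hg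
      rw [intervalIntegral.integral_symm, norm_neg, ← hval]
      refine intervalIntegral.norm_integral_le_of_norm_le hx.2 ?_ hgi
      refine Eventually.of_forall fun t ht => (hg t ht).trans ?_
      rw [mul_assoc]
      exact mul_le_mul_of_nonneg_left (key t ht) (by positivity)
    rw [Prod.norm_def, max_le_iff]
    constructor
    · have e : ((picard hq l c d U) ⟨x, hx⟩ - (picard hq l c d V) ⟨x, hx⟩).1
          = ∫ t in (1 : ℝ)..x, ((ev U t).2 - (ev V t).2) := by
        have hi : ∀ W : C(Icc (0 : ℝ) 1, ℂ × ℂ),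
            IntervalIntegrable (fun t => (ev W t).2) volume 1 x := fun W =>
          (continuous_snd.comp (continuous_ev W)).intervalIntegrable _ _
        rw [intervalIntegral.integral_sub (hi U) (hi V)]
        simp [picard]
      rw [e]
      refine comp _ fun t ht => ?_
      have h1 : ‖(ev U t).2 - (ev V t).2‖ ≤ ‖ev U t - ev V t‖ := norm_snd_le (ev U t - ev V t)
      have h2 : 0 ≤ (|q t| + ‖l‖) * ‖ev U t - ev V t‖ := by positivity
      linarith
    · have hi : ∀ W : C(Icc (0 : ℝ) 1, ℂ × ℂ),
          IntervalIntegrable (fun t => ((q t : ℂ) - l) * (ev W t).1) volume 1 x := fun W =>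
        (intervalIntegrable_potential_mul hq l
        (continuous_fst.comp (continuous_ev W)).continuousOn).mono_set hsub'
      have e : ((picard hq l c d U) ⟨x, hx⟩ - (picard hq l c d V) ⟨x, hx⟩).2
          = ∫ t in (1 : ℝ)..x, (((q t : ℂ) - l) * (ev U t).1 - ((q t : ℂ) - l) * (ev V t).1) := by
        rw [intervalIntegral.integral_sub (hi U) (hi V)]
        simp [picard]
      rw [e]
      refine comp _ fun t ht => ?_
      rw [← mul_sub, norm_mul]
      have h1 : ‖(ev U t).1 - (ev V t).1‖ ≤ ‖ev U t - ev V t‖ := norm_fst_le (ev U t - ev V t)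
      have h2 : ‖(q t : ℂ) - l‖ ≤ 1 + |q t| + ‖l‖ := by
        have := norm_sub_le (q t : ℂ) l
        rw [Complex.norm_real, Real.norm_eq_abs] at this
        linarith
      exact mul_le_mul h2 h1 (norm_nonneg _) (by positivity)

lemma existsUnique_picard {q : ℝ → ℝ} (hq : IntervalIntegrable q volume 0 1) (l c d : ℂ) :
    ∃! Y : C(Icc (0 : ℝ) 1, ℂ × ℂ), picard hq l c d Y = Y := by
  have ha : IntervalIntegrable (fun t => 1 + |q t| + ‖l‖) volume 0 1 :=
    (intervalIntegrable_const.add hq.abs).add intervalIntegrable_const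
  set A : ℝ → ℝ := fun t => ∫ s in t..1, (1 + |q s| + ‖l‖) with hA
  have hlim := FloorSemiring.tendsto_pow_div_factorial_atTop (A 0)
  obtain ⟨n, hn⟩ := (hlim.eventually (gt_mem_nhds (show (0 : ℝ) < 1 / 2 by norm_num))).exists
  have hA0 : ∀ x ∈ Icc (0 : ℝ) 1, 0 ≤ A x ∧ A x ≤ A 0 := by
    intro x hx
    refine ⟨intervalIntegral.integral_nonneg hx.2 fun t _ => by positivity, ?_⟩
    refine intervalIntegral.integral_mono_interval hx.1 hx.2 le_rfl ?_ ha
    exact Eventually.of_forall fun t => by positivity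
  have hc : ContractingWith (1 / 2 : ℝ≥0) (picard hq l c d)^[n] := by
    refine ⟨by rw [← NNReal.coe_lt_coe]; norm_num, LipschitzWith.of_dist_le_mul fun Y Z => ?_⟩
    rw [ContinuousMap.dist_le (by positivity)]
    intro x
    have h := norm_picard_iterate_sub_le hq l c d Y Z n x x.2
    rw [ev_of_mem _ x.2, ev_of_mem _ x.2, ← dist_eq_norm] at h
    refine h.trans ?_
    gcongr
    have h1 : A x ^ n / n.factorial ≤ A 0 ^ n / n.factorial := by
      have := hA0 x x.2
      exact div_le_div_of_nonneg_right (pow_le_pow_left₀ this.1 this.2 n) (by positivity)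
    refine (h1.trans hn.le).trans ?_
    simp
  refine ⟨_, hc.isFixedPt_fixedPoint_iterate, fun Z hZ => ?_⟩
  exact hc.fixedPoint_unique (Function.IsFixedPt.iterate hZ n)

lemma intervalIntegrable_of_mem {q : ℝ → ℝ} (hq : q ∈ PotentialClass 1) {a b : ℝ}
    (ha : 0 ≤ a) (hb : 0 ≤ b) : IntervalIntegrable q volume a b := by
  have h := memLp_one_iff_integrable.mp hq.1
  rw [intervalIntegrable_iff]
  exact IntegrableOn.mono_set h fun t ht => (le_min ha hb).trans ht.1.le

lemma hasDerivAt_exp (k : ℂ) (x : ℝ) :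
    HasDerivAt (fun t : ℝ => Complex.exp (Complex.I * k * t))
      (Complex.I * k * Complex.exp (Complex.I * k * x)) x := by
  have h := ((Complex.ofRealCLM.hasDerivAt (x := x)).const_mul (Complex.I * k)).cexp
  simpa [mul_comm] using h

lemma IsSolutionOn.continuousOn_deriv_Icc {q : ℝ → ℝ} (hq : IntervalIntegrable q volume 0 1)
    {l : ℂ} {y y' : ℝ → ℂ} (h : IsSolutionOn q l (Icc 0 1) y y') : ContinuousOn y' (Icc 0 1) := by
  have hy : ContinuousOn y (Icc 0 1) := fun x hx => (h.hasDeriv x hx).continuousWithinAt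
  rw [continuousOn_iff_continuous_domRestrict]
  have hc := (continuous_const (y := y' 1)).add
    (continuous_primitive_Icc (intervalIntegrable_potential_mul hq l hy))
  refine hc.congr fun x => ?_
  have := h.integral_eq 1 (by simp) x x.2
  simp only [Pi.add_apply, domRestrict_apply]
  rw [← this]
  ring

lemma IsSolutionOn.eqOn_of_eq_at_one {q : ℝ → ℝ} (hq : IntervalIntegrable q volume 0 1)
    {l : ℂ} {y y' z z' : ℝ → ℂ} (hy : IsSolutionOn q l (Icc 0 1) y y')
    (hz : IsSolutionOn q l (Icc 0 1) z z') (h₁ : y 1 = z 1) (h₂ : y' 1 = z' 1) :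
    EqOn y z (Icc 0 1) := by
  have main : ∀ w w' : ℝ → ℂ, IsSolutionOn q l (Icc 0 1) w w' →
      ∃ W : C(Icc (0 : ℝ) 1, ℂ × ℂ), (∀ x : Icc (0 : ℝ) 1, W x = (w x, w' x)) ∧
        picard hq l (w 1) (w' 1) W = W := by
    intro w w' h
    have hwc : ContinuousOn w (Icc 0 1) := fun x hx => (h.hasDeriv x hx).continuousWithinAt
    have hwc' := h.continuousOn_deriv_Icc hq
    obtain ⟨W, hW⟩ : ∃ W : C(Icc (0 : ℝ) 1, ℂ × ℂ), ∀ x : Icc (0 : ℝ) 1, W x = (w x, w' x) :=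
      ⟨⟨fun x => (w x, w' x), (continuousOn_iff_continuous_domRestrict.mp hwc).prodMk
        (continuousOn_iff_continuous_domRestrict.mp hwc')⟩, fun x => rfl⟩
    refine ⟨W, hW, ?_⟩
    ext1 x
    obtain ⟨x, hx⟩ := x
    have hsub : uIcc 1 x ⊆ Icc (0 : ℝ) 1 := by
      rw [uIcc_of_ge hx.2]
      exact Icc_subset_Icc_left hx.1
    have e1 : w x = w 1 + ∫ t in (1 : ℝ)..x, w' t := by
      have hsub' : Icc x 1 ⊆ Icc (0 : ℝ) 1 := Icc_subset_Icc_left hx.1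
      have := intervalIntegral.integral_eq_sub_of_hasDeriv_right_of_le hx.2 (hwc.mono hsub')
        (fun t ht => ((h.hasDeriv t ⟨hx.1.trans ht.1.le, ht.2.le⟩).hasDerivAt
          (Icc_mem_nhds (hx.1.trans_lt ht.1) ht.2)).hasDerivWithinAt)
        ((hwc'.mono hsub').intervalIntegrable_of_Icc hx.2)
      rw [intervalIntegral.integral_symm, this]
      ring
    have e2 : w' x = w' 1 + ∫ t in (1 : ℝ)..x, ((q t : ℂ) - l) * w t := by
      rw [← h.integral_eq 1 (by simp) x hx]
      ring
    have c1 : ∀ t ∈ uIcc 1 x, ev W t = (w t, w' t) := by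
      intro t ht
      rw [ev_of_mem W (hsub ht), hW]
    have i1 : ∫ t in (1 : ℝ)..x, (ev W t).2 = ∫ t in (1 : ℝ)..x, w' t :=
      intervalIntegral.integral_congr fun t ht => by simp only [c1 t ht]
    have i2 : ∫ t in (1 : ℝ)..x, ((q t : ℂ) - l) * (ev W t).1
        = ∫ t in (1 : ℝ)..x, ((q t : ℂ) - l) * w t :=
      intervalIntegral.integral_congr fun t ht => by simp only [c1 t ht]
    rw [hW]
    simp only [picard, ContinuousMap.coe_mk]
    rw [i1, i2, e1, e2]
  obtain ⟨Y, hY, hYf⟩ := main y y' hy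
  obtain ⟨Z, hZ, hZf⟩ := main z z' hz
  rw [← h₁, ← h₂] at hZf
  have hYZ := (existsUnique_picard hq l (y 1) (y' 1)).unique hYf hZf
  intro x hx
  have h1 := hY ⟨x, hx⟩
  rw [hYZ, hZ ⟨x, hx⟩] at h1
  exact (congrArg Prod.fst h1).symm

/-- For `q ∈ 𝓛^1` and `k ∈ ℂ` a Jost solution exists. -/
theorem exists_isJostSolution {q : ℝ → ℝ} (hq : q ∈ PotentialClass 1) (k : ℂ) :
    ∃ f, IsJostSolution q k f := by
  have hqi : IntervalIntegrable q volume 0 1 := intervalIntegrable_of_mem hq le_rfl zero_le_one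
  set E : ℝ → ℂ := fun t => Complex.exp (Complex.I * k * t) with hE
  have hEd : ∀ x, HasDerivAt E (Complex.I * k * E x) x := hasDerivAt_exp k
  have hEc : Continuous E := continuous_iff_continuousAt.mpr fun x => (hEd x).continuousAt
  obtain ⟨Y, hY, -⟩ := existsUnique_picard hqi (k ^ 2) (E 1) (Complex.I * k * E 1)
  have hYev : ∀ x ∈ Icc (0 : ℝ) 1, ev Y x = (E 1 + ∫ t in (1 : ℝ)..x, (ev Y t).2,
      Complex.I * k * E 1 + ∫ t in (1 : ℝ)..x, ((q t : ℂ) - k ^ 2) * (ev Y t).1) := by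
    intro x hx
    rw [ev_of_mem Y hx]
    conv_lhs => rw [← hY]
    rfl
  have hY1 : ev Y 1 = (E 1, Complex.I * k * E 1) := by
    rw [hYev 1 (by simp)]
    simp
  set f : ℝ → ℂ := fun x => if x ≤ 1 then (ev Y x).1 else E x with hf
  set f' : ℝ → ℂ := fun x => if x ≤ 1 then (ev Y x).2 else Complex.I * k * E x with hf'
  have hfc : Continuous f := by
    refine Continuous.if_le (continuous_fst.comp (continuous_ev Y)) hEc continuous_id
      continuous_const ?_
    intro x hx
    simp [hx, hY1]
  have hfc' : Continuous f' := by
    refine Continuous.if_le (continuous_snd.comp (continuous_ev Y)) (continuous_const.mul hEc)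
      continuous_id continuous_const ?_
    intro x hx
    simp [hx, hY1]
  have hfle : ∀ x ≤ 1, f x = (ev Y x).1 ∧ f' x = (ev Y x).2 := by
    intro x hx
    simp [hf, hf', hx]
  have hfge : ∀ x ≥ 1, f x = E x ∧ f' x = Complex.I * k * E x := by
    intro x hx
    rcases eq_or_lt_of_le hx with rfl | hx
    · simp [hf, hf', hY1]
    · simp [hf, hf', not_le.mpr hx]
  have claim1 : ∀ x ≥ 0, f x = E 1 + ∫ t in (1 : ℝ)..x, f' t := by
    intro x hx
    rcases le_total x 1 with h | h
    · rw [(hfle x h).1, hYev x ⟨hx, h⟩]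
      simp only
      congr 1
      refine intervalIntegral.integral_congr fun t ht => ?_
      rw [uIcc_of_ge h] at ht
      exact (hfle t ht.2).2.symm
    · have e : ∫ t in (1 : ℝ)..x, f' t = ∫ t in (1 : ℝ)..x, Complex.I * k * E t := by
        refine intervalIntegral.integral_congr fun t ht => ?_
        rw [uIcc_of_le h] at ht
        exact (hfge t ht.1).2
      rw [e, intervalIntegral.integral_eq_sub_of_hasDerivAt (fun t _ => hEd t)
        ((continuous_const.mul hEc).intervalIntegrable _ _), (hfge x h).1]
      ring
  have claim2 : ∀ x ≥ 0, f' x = Complex.I * k * E 1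
      + ∫ t in (1 : ℝ)..x, ((q t : ℂ) - k ^ 2) * f t := by
    intro x hx
    rcases le_total x 1 with h | h
    · rw [(hfle x h).2, hYev x ⟨hx, h⟩]
      simp only
      congr 1
      refine intervalIntegral.integral_congr fun t ht => ?_
      rw [uIcc_of_ge h] at ht
      simp only [(hfle t ht.2).1]
    · have e : ∫ t in (1 : ℝ)..x, ((q t : ℂ) - k ^ 2) * f t
          = ∫ t in (1 : ℝ)..x, Complex.I * k * (Complex.I * k * E t) := by
        refine intervalIntegral.integral_congr_ae ?_
        have hz := (ae_restrict_iff' measurableSet_Ioi).mp hq.2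
        filter_upwards [hz] with t ht htm
        rw [uIoc_of_le h] at htm
        rw [ht htm.1, (hfge t htm.1.le).1]
        rw [Complex.ofReal_zero]
        linear_combination (-(k ^ 2) * E t) * Complex.I_sq
      rw [e, intervalIntegral.integral_eq_sub_of_hasDerivAt
        (fun t _ => (hEd t).const_mul (Complex.I * k))
        ((continuous_const.mul (continuous_const.mul hEc)).intervalIntegrable _ _), (hfge x h).2]
      ring
  refine ⟨f, ⟨f', ?_, ?_⟩, fun x hx => (hfge x hx).1⟩
  · intro x hx
    have h1 : HasDerivAt (fun u => E 1 + ∫ t in (1 : ℝ)..u, f' t) (f' x) x :=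
      (intervalIntegral.integral_hasDerivAt_right (hfc'.intervalIntegrable _ _)
        (hfc'.stronglyMeasurableAtFilter _ _) hfc'.continuousAt).const_add _
    exact h1.hasDerivWithinAt.congr (fun u hu => claim1 u hu) (claim1 x hx)
  · intro a ha b hb
    have hi : ∀ x ≥ (0 : ℝ), IntervalIntegrable (fun t => ((q t : ℂ) - k ^ 2) * f t) volume 1 x := by
      intro x hx
      have h0 : IntervalIntegrable (fun t => (q t : ℂ)) volume 1 x := by
        have := intervalIntegrable_of_mem hq zero_le_one hx
        rw [intervalIntegrable_iff] at this ⊢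
        exact Integrable.ofReal this
      exact (h0.sub intervalIntegrable_const).mul_continuousOn hfc.continuousOn
    rw [claim2 a ha, claim2 b hb, ← intervalIntegral.integral_interval_sub_left (hi b hb) (hi a ha)]
    ring

/-- For `q ∈ 𝓛^1` the Jost solution is unique on `[0, ∞)`. -/
theorem IsJostSolution.eqOn {q : ℝ → ℝ} (hq : q ∈ PotentialClass 1) {k : ℂ} {f g : ℝ → ℂ}
    (hf : IsJostSolution q k f) (hg : IsJostSolution q k g) : EqOn f g (Ici 0) := by
  have hqi : IntervalIntegrable q volume 0 1 := intervalIntegrable_of_mem hq le_rfl zero_le_one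
  obtain ⟨⟨f', hf'⟩, hf1⟩ := hf
  obtain ⟨⟨g', hg'⟩, hg1⟩ := hg
  have hres : ∀ w w' : ℝ → ℂ, IsSolutionOn q (k ^ 2) (Ici 0) w w' →
      IsSolutionOn q (k ^ 2) (Icc 0 1) w w' := fun w w' h =>
    ⟨fun x hx => (h.hasDeriv x hx.1).mono Icc_subset_Ici_self,
      fun a ha b hb => h.integral_eq a ha.1 b hb.1⟩
  have hder : ∀ w w' : ℝ → ℂ, IsSolutionOn q (k ^ 2) (Ici 0) w w' →
      (∀ x : ℝ, 1 ≤ x → w x = Complex.exp (Complex.I * k * x)) →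
      w' 1 = Complex.I * k * Complex.exp (Complex.I * k * (1 : ℝ)) := by
    intro w w' h hw
    have h1 : HasDerivWithinAt w (w' 1) (Ici 1) 1 :=
      (h.hasDeriv 1 (by simp)).mono (Ici_subset_Ici.mpr zero_le_one)
    have h2 := (hasDerivAt_exp k 1).hasDerivWithinAt (s := Ici 1)
    exact (uniqueDiffOn_Ici (1 : ℝ) 1 (by simp)).eq_deriv _ h1
      (h2.congr (fun x hx => hw x hx) (hw 1 le_rfl))
  intro x hx
  rcases le_total x 1 with h | h
  · exact (hres f f' hf').eqOn_of_eq_at_one hqi (hres g g' hg')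
      ((hf1 1 le_rfl).trans (hg1 1 le_rfl).symm)
      ((hder f f' hf' hf1).trans (hder g g' hg' hg1).symm) ⟨hx, h⟩
  · rw [hf1 x h, hg1 x h]

/-! ### Jost function, S-matrix, phase shift -/

/-- The Jost solution `f₊(x, k)` of the potential `q`; see `isJostSolution_jostSolution` and
`IsJostSolution.eqOn` for its characterization. -/
noncomputable def jostSolution (q : ℝ → ℝ) (k : ℂ) : ℝ → ℂ :=
  Classical.epsilon (IsJostSolution q k)

theorem isJostSolution_jostSolution {q : ℝ → ℝ} (hq : q ∈ PotentialClass 1) (k : ℂ) :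
    IsJostSolution q k (jostSolution q k) :=
  Classical.epsilon_spec (exists_isJostSolution hq k)

/-- The Jost function `ψ(k) = f₊(0, k)`. -/
noncomputable def jostFunction (q : ℝ → ℝ) (k : ℂ) : ℂ := jostSolution q k 0

/-- The class `𝓛_+^α` of potentials in `𝓛^α` whose Jost function has no zeros in the open upper
half-plane. -/
def PotentialClassPlus (α : ℝ≥0∞) : Set (ℝ → ℝ) :=
  {q | q ∈ PotentialClass α ∧ ∀ k : ℂ, 0 < k.im → jostFunction q k ≠ 0}

/-- The scattering matrix `S(k) = ψ(-k) / ψ(k)`. -/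
noncomputable def scatteringMatrix (q : ℝ → ℝ) (k : ℝ) : ℂ :=
  jostFunction q (-k) / jostFunction q k

/-- `ξ` is the phase shift of `q`: the odd function on `ℝ \ {0}`, continuous there, with
`S(k) = exp (-2 i ξ(k))` and `ξ(k) = O(1/k)` as `k → ±∞`.  Since the phase shift is considered on
the closed half-line `[0, ∞)`, its value at `0` is the one-sided limit `ξ(+0)`. -/
structure IsPhaseShift (q : ℝ → ℝ) (ξ : ℝ → ℝ) : Prop where
  continuousOn : ContinuousOn ξ {0}ᶜ
  odd : ∀ k : ℝ, k ≠ 0 → ξ (-k) = -ξ k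
  exp_eq : ∀ k : ℝ, k ≠ 0 → scatteringMatrix q k = Complex.exp (-2 * Complex.I * ξ k)
  isBigO_atTop : ξ =O[atTop] fun k : ℝ => k⁻¹
  isBigO_atBot : ξ =O[atBot] fun k : ℝ => k⁻¹
  tendsto_right : Tendsto ξ (𝓝[>] 0) (𝓝 (ξ 0))

/-! ### Sturm–Liouville problems on the unit interval -/

/-- Eigenvalues of `-y'' + q y = l y`, `y 0 = y 1 = 0` on `[0, 1]`. -/
def dirichletEigenvalues (q : ℝ → ℝ) : Set ℂ :=
  {l | ∃ y y' : ℝ → ℂ, IsSolutionOn q l (Icc 0 1) y y' ∧ (∃ x ∈ Icc (0 : ℝ) 1, y x ≠ 0) ∧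
    y 0 = 0 ∧ y 1 = 0}

/-- Eigenvalues of `-y'' + q y = l y`, `y 0 = y' 1 = 0` on `[0, 1]`. -/
def dirichletNeumannEigenvalues (q : ℝ → ℝ) : Set ℂ :=
  {l | ∃ y y' : ℝ → ℂ, IsSolutionOn q l (Icc 0 1) y y' ∧ (∃ x ∈ Icc (0 : ℝ) 1, y x ≠ 0) ∧
    y 0 = 0 ∧ y' 1 = 0}

/-- `u 1 < u 2 < u 3 < ...` is the list, in increasing order and without repetitions, of all
elements of the set `S` (in particular, all of them are real).  The value `u 0` is irrelevant. -/
def IsIncreasingList (u : ℕ → ℝ) (S : Set ℂ) : Prop :=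
  (∀ m n : ℕ, 1 ≤ m → m < n → u m < u n) ∧ ∀ l : ℂ, l ∈ S ↔ ∃ n : ℕ, 1 ≤ n ∧ l = (u n : ℂ)

end HalfLine

namespace HalfLine

/-! ### Absolutely continuous functions on the unit interval -/

/-! Everything is read off from the real solution `φ l` with `φ l 0 = 0`, `φ' l 0 = 1`. Its
Wronskian with the Jost solution gives `ψ(k) = exp(ik) (φ' - ikφ)` at `x = 1`, `l = k²`, whenever
`k²` is real (`jostFunction_eq`). In polar coordinates `(φ', kφ) = r (cos θ, sin θ)` the angle
satisfies `θ' = k - k q φ² / (φ'² + k² φ²)`. Hence the angle at `1` is `k - ξ(k)` with an explicit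
integral `ξ` bounded by `‖q‖₁ / |k|`, and `ψ(-k)/ψ(k) = exp(-2iξ)` (`IsSol.exists_prufer`,
`scatteringMatrix_eq`). Two phase shifts differ by multiples of `π`, continuously and with limit `0`
at infinity, so they coincide.

Monotonicity is where the absence of bound states enters. The decaying solution `G κ` at energy
`-κ²` does not vanish at `0`, and a deformation from large `κ` shows that it is positive on `[0, 1]`
(`IsDecayFamily.pos`). Picone's identity, as `κ → 0`, then yields `φ φ' + l ∫ φ² ≥ 0` at `x = 1`
(`noBoundState`). By the Lagrange identity the derivative of `k - ξ(k)` is a positive multiple of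
`2k² ∫ φ² + φ φ'`, hence positive for `k ≠ 0`. At `k = 0` the angle starts from `π/2` if `φ' 0 1 =
0` (zero-energy resonance) and from `0` otherwise; both cases have a positive one-sided derivative.

Eigenvalues are real by self-adjointness and nonnegative by the same quadratic form. For `k > 0`,
`k²` is a Dirichlet eigenvalue iff `sin (k - ξ) = 0` and a Dirichlet–Neumann one iff `cos (k - ξ) =
0`, so monotonicity enumerates them by the even and odd multiples of `π/2`.

For the asymptotics, `2kξ = ∫ q (1 - cos 2θ)`, and at `k = p n` one has `2θ(x) = πnx + O(1/k)`. Thus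
`σ n` is minus the cosine coefficient of `q` up to `O(1/n)`; Riemann–Lebesgue and Parseval finish.
-/

lemma absolutelyContinuousOnInterval_of_dist_le {X Y : Type*} [PseudoMetricSpace X]
    [PseudoMetricSpace Y] {f : ℝ → X} {g : ℝ → Y} {a b K : ℝ}
    (hg : AbsolutelyContinuousOnInterval g a b)
    (h : ∀ x ∈ uIcc a b, ∀ y ∈ uIcc a b, dist (f x) (f y) ≤ K * dist (g x) (g y)) :
    AbsolutelyContinuousOnInterval f a b := by
  unfold AbsolutelyContinuousOnInterval at hg ⊢
  have h0 := hg.const_mul K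
  rw [mul_zero] at h0
  refine squeeze_zero' (Eventually.of_forall fun E => Finset.sum_nonneg fun _ _ => dist_nonneg)
    ?_ h0
  refine eventually_inf_principal.mpr (Eventually.of_forall fun E hE => ?_)
  rw [Finset.mul_sum]
  exact Finset.sum_le_sum fun i hi => h _ (hE.1 i hi).1 _ (hE.1 i hi).2

variable {𝕜 : Type*} [RCLike 𝕜]

/-- `F` is a primitive on `[0, 1]` of the integrable function `f`. -/
structure IsPrimitive (F f : ℝ → 𝕜) : Prop where
  integrable : IntervalIntegrable f volume 0 1
  eq_add : ∀ x ∈ Icc (0 : ℝ) 1, F x = F 0 + ∫ t in (0 : ℝ)..x, f t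

lemma intervalIntegrable_mono {f : ℝ → 𝕜} (hf : IntervalIntegrable f volume 0 1) {a b : ℝ}
    (ha : a ∈ Icc (0 : ℝ) 1) (hb : b ∈ Icc (0 : ℝ) 1) : IntervalIntegrable f volume a b := by
  refine hf.mono_set (uIcc_subset_uIcc ?_ ?_) <;> rwa [uIcc_of_le zero_le_one]

/-! ### Calculus of primitives of integrable functions on the unit interval. -/

namespace IsPrimitive

variable {F G f g : ℝ → 𝕜}

lemma sub_eq (h : IsPrimitive F f) {a b : ℝ} (ha : a ∈ Icc (0 : ℝ) 1)
    (hb : b ∈ Icc (0 : ℝ) 1) : F b - F a = ∫ t in a..b, f t := by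
  have h0 : (0 : ℝ) ∈ Icc (0 : ℝ) 1 := by simp
  rw [h.eq_add a ha, h.eq_add b hb, ← intervalIntegral.integral_interval_sub_left
    (intervalIntegrable_mono h.integrable h0 hb) (intervalIntegrable_mono h.integrable h0 ha)]
  ring

lemma of_sub_eq (hf : IntervalIntegrable f volume 0 1)
    (h : ∀ x ∈ Icc (0 : ℝ) 1, F x - F 0 = ∫ t in (0 : ℝ)..x, f t) : IsPrimitive F f :=
  ⟨hf, fun x hx => by rw [← h x hx]; ring⟩

lemma absolutelyContinuous (h : IsPrimitive F f) : AbsolutelyContinuousOnInterval F 0 1 := by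
  have hn : IntervalIntegrable (fun t => ‖f t‖) volume 0 1 := h.integrable.norm
  refine absolutelyContinuousOnInterval_of_dist_le (K := 1)
    (hn.absolutelyContinuousOnInterval_intervalIntegral (c := 0) (by simp)) ?_
  intro x hx y hy
  rw [uIcc_of_le zero_le_one] at hx hy
  have h0 : (0 : ℝ) ∈ Icc (0 : ℝ) 1 := by simp
  rw [dist_eq_norm, h.sub_eq hy hx, one_mul, Real.dist_eq,
    intervalIntegral.integral_interval_sub_left (intervalIntegrable_mono h.integrable h0 hx).norm
      (intervalIntegrable_mono h.integrable h0 hy).norm]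
  exact intervalIntegral.norm_integral_le_abs_integral_norm

lemma continuousOn (h : IsPrimitive F f) : ContinuousOn F (Icc 0 1) := by
  have := h.absolutelyContinuous.continuousOn
  rwa [uIcc_of_le zero_le_one] at this

lemma ae_hasDerivAt (h : IsPrimitive F f) : ∀ᵐ x, x ∈ Icc (0 : ℝ) 1 → HasDerivAt F (f x) x := by
  have h1 : ∀ᵐ x : ℝ, x ≠ 0 := by simp [ae_iff, measure_singleton]
  have h2 : ∀ᵐ x : ℝ, x ≠ 1 := by simp [ae_iff, measure_singleton]
  filter_upwards [h.integrable.ae_hasDerivAt_integral, h1, h2] with x hx hx0 hx1 hxI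
  have hd := (hx (by rwa [uIcc_of_le zero_le_one]) 0 (by simp)).const_add (F 0)
  refine hd.congr_of_eventuallyEq ?_
  filter_upwards [Icc_mem_nhds (lt_of_le_of_ne hxI.1 hx0.symm) (lt_of_le_of_ne hxI.2 hx1)]
    with y hy using h.eq_add y hy

/-- The difference between `F` and the integral of `f` is absolutely continuous with derivative zero
almost everywhere, hence constant. This reduces the product rule and the chain rule for `exp` to
almost-everywhere derivatives. -/
lemma of_absolutelyContinuous (hF : AbsolutelyContinuousOnInterval F 0 1)
    (hf : IntervalIntegrable f volume 0 1)
    (hd : ∀ᵐ x, x ∈ Icc (0 : ℝ) 1 → HasDerivAt F (f x) x) : IsPrimitive F f := by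
  have hP : IsPrimitive (fun x => ∫ t in (0 : ℝ)..x, f t) f := ⟨hf, fun x _ => by simp⟩
  obtain ⟨C, hC⟩ := (hF.sub hP.absolutelyContinuous).const_of_ae_hasDerivAt_zero (by
    filter_upwards [hd, hP.ae_hasDerivAt] with x h1 h2 hx
    rw [uIcc_of_le zero_le_one] at hx
    simpa using (h1 hx).sub (h2 hx))
  rw [uIcc_of_le zero_le_one] at hC
  refine ⟨hf, fun x hx => ?_⟩
  have h1 := hC x hx
  have h0 := hC 0 (by simp)
  simp only [Pi.sub_apply, intervalIntegral.integral_same, sub_zero] at h0 h1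
  rw [h0, ← h1]
  ring

lemma mul (hF : IsPrimitive F f) (hG : IsPrimitive G g) :
    IsPrimitive (fun x => F x * G x) (fun x => f x * G x + F x * g x) := by
  have cF := hF.continuousOn
  have cG := hG.continuousOn
  rw [← uIcc_of_le zero_le_one] at cF cG
  refine of_absolutelyContinuous (hF.absolutelyContinuous.smul hG.absolutelyContinuous)
    ((hF.integrable.mul_continuousOn cG).add (hG.integrable.continuousOn_mul cF)) ?_
  filter_upwards [hF.ae_hasDerivAt, hG.ae_hasDerivAt] with x h1 h2 hx
  exact (h1 hx).mul (h2 hx)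

lemma sub (hF : IsPrimitive F f) (hG : IsPrimitive G g) :
    IsPrimitive (fun x => F x - G x) (fun x => f x - g x) := by
  refine of_absolutelyContinuous (hF.absolutelyContinuous.sub hG.absolutelyContinuous)
    (hF.integrable.sub hG.integrable) ?_
  filter_upwards [hF.ae_hasDerivAt, hG.ae_hasDerivAt] with x h1 h2 hx
  exact (h1 hx).sub (h2 hx)

lemma add (hF : IsPrimitive F f) (hG : IsPrimitive G g) :
    IsPrimitive (fun x => F x + G x) (fun x => f x + g x) := by
  refine of_absolutelyContinuous (hF.absolutelyContinuous.add hG.absolutelyContinuous)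
    (hF.integrable.add hG.integrable) ?_
  filter_upwards [hF.ae_hasDerivAt, hG.ae_hasDerivAt] with x h1 h2 hx
  exact (h1 hx).add (h2 hx)

lemma const_mul (c : 𝕜) (hF : IsPrimitive F f) :
    IsPrimitive (fun x => c * F x) (fun x => c * f x) :=
  ⟨hF.integrable.const_mul c, fun x hx => by
    rw [hF.eq_add x hx, intervalIntegral.integral_const_mul]; ring⟩

lemma congr_right (hF : IsPrimitive F f) (h : ∀ x ∈ Icc (0 : ℝ) 1, f x = g x) :
    IsPrimitive F g := by
  have h0 : (0 : ℝ) ∈ Icc (0 : ℝ) 1 := by simp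
  refine ⟨hF.integrable.congr fun x hx => h x ?_, fun x hx => ?_⟩
  · rw [uIoc_of_le zero_le_one] at hx
    exact ⟨hx.1.le, hx.2⟩
  · rw [hF.eq_add x hx]
    congr 1
    refine intervalIntegral.integral_congr fun t ht => h t ?_
    rw [uIcc_of_le hx.1] at ht
    exact ⟨ht.1, ht.2.trans hx.2⟩

lemma of_hasDerivWithinAt (hd : ∀ x ∈ Icc (0 : ℝ) 1, HasDerivWithinAt F (f x) (Icc 0 1) x)
    (hf : ContinuousOn f (Icc 0 1)) : IsPrimitive F f := by
  refine of_sub_eq (hf.intervalIntegrable_of_Icc zero_le_one) fun x hx => ?_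
  have hs : Icc 0 x ⊆ Icc (0 : ℝ) 1 := Icc_subset_Icc_right hx.2
  refine (intervalIntegral.integral_eq_sub_of_hasDeriv_right_of_le hx.1
    (fun t ht => ((hd t (hs ht)).mono hs).continuousWithinAt) (fun t ht => ?_)
    ((hf.mono hs).intervalIntegrable_of_Icc hx.1)).symm
  exact ((hd t (hs (Ioo_subset_Icc_self ht))).hasDerivAt
    (Icc_mem_nhds ht.1 (ht.2.trans_le hx.2))).hasDerivWithinAt

lemma hasDerivWithinAt (h : IsPrimitive F f) (hf : ContinuousOn f (Icc 0 1)) {x : ℝ}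
    (hx : x ∈ Icc (0 : ℝ) 1) : HasDerivWithinAt F (f x) (Icc 0 1) x := by
  have h0 : (0 : ℝ) ∈ Icc (0 : ℝ) 1 := by simp
  have : Fact (x ∈ Icc (0 : ℝ) 1) := ⟨hx⟩
  have hd : HasDerivWithinAt (fun u => F 0 + ∫ t in (0 : ℝ)..u, f t) (f x) (Icc 0 1) x :=
    (intervalIntegral.integral_hasDerivWithinAt_right (intervalIntegrable_mono h.integrable h0 hx)
      (hf.stronglyMeasurableAtFilter_nhdsWithin measurableSet_Icc x) (hf x hx)).const_add _
  exact hd.congr (fun u hu => h.eq_add u hu) (h.eq_add x hx)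

lemma eq_of_zero (h : IsPrimitive F f) (hf : ∀ x ∈ Icc (0 : ℝ) 1, f x = 0) {a b : ℝ}
    (ha : a ∈ Icc (0 : ℝ) 1) (hb : b ∈ Icc (0 : ℝ) 1) : F a = F b := by
  have h1 := (h.congr_right hf).sub_eq ha hb
  simp only [intervalIntegral.integral_zero] at h1
  exact (sub_eq_zero.mp h1).symm

end IsPrimitive

/-- The compact image of `F` lies in a ball, on which the `C¹` function `exp` is Lipschitz; so
absolute continuity passes to `exp ∘ F`. -/
lemma IsPrimitive.cexp {F f : ℝ → ℂ} (hF : IsPrimitive F f) :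
    IsPrimitive (fun x => Complex.exp (F x)) (fun x => Complex.exp (F x) * f x) := by
  have cF := hF.continuousOn
  have cF' := cF
  rw [← uIcc_of_le zero_le_one] at cF'
  obtain ⟨R, hR⟩ := (isCompact_Icc.image_of_continuousOn cF).isBounded.subset_closedBall 0
  obtain ⟨K, hK⟩ := (Complex.contDiff_exp (n := 1) (𝕜 := ℝ)).contDiffOn.exists_lipschitzOnWith
    one_ne_zero (convex_closedBall (0 : ℂ) R) (isCompact_closedBall 0 R)
  refine of_absolutelyContinuous (absolutelyContinuousOnInterval_of_dist_le (K := K)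
    hF.absolutelyContinuous fun x hx y hy => ?_)
    (hF.integrable.continuousOn_mul (Complex.continuous_exp.comp_continuousOn cF')) ?_
  · rw [uIcc_of_le zero_le_one] at hx hy
    exact hK.dist_le_mul _ (hR (mem_image_of_mem F hx)) _ (hR (mem_image_of_mem F hy))
  · filter_upwards [hF.ae_hasDerivAt] with x h1 hx
    exact (h1 hx).cexp

end HalfLine

namespace HalfLine

/-! ### Solutions on the unit interval -/

/-- `y` solves `-y'' + q y = l y` on `[0, 1]`, with derivative `y'`; the scalars are real or
complex. -/
structure IsSol {𝕜 : Type*} [RCLike 𝕜] (q : ℝ → ℝ) (l : 𝕜) (y y' : ℝ → 𝕜) : Prop where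
  prim : IsPrimitive y y'
  prim' : IsPrimitive y' fun t => ((q t : 𝕜) - l) * y t

lemma IsSolutionOn.isSol {q : ℝ → ℝ} (hq : IntervalIntegrable q volume 0 1) {l : ℂ}
    {y y' : ℝ → ℂ} (h : IsSolutionOn q l (Icc 0 1) y y') : IsSol q l y y' :=
  ⟨.of_hasDerivWithinAt h.hasDeriv (h.continuousOn_deriv_Icc hq),
    .of_sub_eq (intervalIntegrable_potential_mul hq l
      fun x hx => (h.hasDeriv x hx).continuousWithinAt)
      fun x hx => h.integral_eq 0 (by simp) x hx⟩

lemma IsSolutionOn.mono {q : ℝ → ℝ} {l : ℂ} {I J : Set ℝ} {y y' : ℝ → ℂ}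
    (h : IsSolutionOn q l I y y') (hJ : J ⊆ I) : IsSolutionOn q l J y y' :=
  ⟨fun x hx => (h.hasDeriv x (hJ hx)).mono hJ, fun a ha b hb => h.integral_eq a (hJ ha) b (hJ hb)⟩

lemma IsSol.isSolutionOn {q : ℝ → ℝ} {l : ℂ} {y y' : ℝ → ℂ} (h : IsSol q l y y') :
    IsSolutionOn q l (Icc 0 1) y y' :=
  ⟨fun _ hx => h.prim.hasDerivWithinAt h.prim'.continuousOn hx,
    fun _ ha _ hb => h.prim'.sub_eq ha hb⟩

lemma IsPrimitive.ofReal {F f : ℝ → ℝ} (h : IsPrimitive F f) :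
    IsPrimitive (fun x => (F x : ℂ)) (fun x => (f x : ℂ)) := by
  refine ⟨?_, fun x hx => ?_⟩
  · have := h.integrable
    rw [intervalIntegrable_iff] at this ⊢
    exact Integrable.ofReal this
  · rw [h.eq_add x hx, intervalIntegral.integral_ofReal]
    push_cast
    rfl

lemma IsPrimitive.clm_comp {F f : ℝ → ℂ} (h : IsPrimitive F f) {𝕜 : Type*} [RCLike 𝕜]
    (T : ℂ →L[ℝ] 𝕜) :
    IsPrimitive (fun x => T (F x)) (fun x => T (f x)) := by
  have h0 : (0 : ℝ) ∈ Icc (0 : ℝ) 1 := by simp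
  refine ⟨?_, fun x hx => ?_⟩
  · have := h.integrable
    rw [intervalIntegrable_iff] at this ⊢
    exact T.integrable_comp this
  · rw [T.intervalIntegral_comp_comm (intervalIntegrable_mono h.integrable h0 hx), h.eq_add x hx,
      map_add]

/-! ### Wronskians and linear operations on solutions. -/

namespace IsSol

section General

variable {𝕜 : Type*} [RCLike 𝕜] {q r : ℝ → ℝ} {l m : 𝕜} {y y' z z' : ℝ → 𝕜}

lemma continuousOn (h : IsSol q l y y') : ContinuousOn y (Icc 0 1) := h.prim.continuousOn

lemma continuousOn' (h : IsSol q l y y') : ContinuousOn y' (Icc 0 1) := h.prim'.continuousOn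

/-- The Lagrange identity. -/
lemma wronskian (h : IsSol q l y y') (hz : IsSol r m z z') :
    IsPrimitive (fun x => y x * z' x - y' x * z x)
      (fun x => (((r x : 𝕜) - m) - (q x - l)) * (y x * z x)) :=
  ((h.prim.mul hz.prim').sub (h.prim'.mul hz.prim)).congr_right fun x _ => by ring

lemma wronskian_eq (h : IsSol q l y y') (hz : IsSol q l z z') {a b : ℝ}
    (ha : a ∈ Icc (0 : ℝ) 1) (hb : b ∈ Icc (0 : ℝ) 1) :
    y a * z' a - y' a * z a = y b * z' b - y' b * z b :=
  (h.wronskian hz).eq_of_zero (fun x _ => by ring) ha hb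

lemma lagrange (h : IsSol q l y y') (hz : IsSol q m z z') {a b : ℝ}
    (ha : a ∈ Icc (0 : ℝ) 1) (hb : b ∈ Icc (0 : ℝ) 1) :
    (y b * z' b - y' b * z b) - (y a * z' a - y' a * z a) = (l - m) * ∫ t in a..b, y t * z t := by
  rw [(h.wronskian hz).sub_eq ha hb, ← intervalIntegral.integral_const_mul]
  exact intervalIntegral.integral_congr fun t _ => by ring

lemma const_mul (c : 𝕜) (h : IsSol q l y y') : IsSol q l (fun x => c * y x) (fun x => c * y' x) :=
  ⟨h.prim.const_mul c, (h.prim'.const_mul c).congr_right fun x _ => by ring⟩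

lemma sub (h : IsSol q l y y') (hz : IsSol q l z z') :
    IsSol q l (fun x => y x - z x) (fun x => y' x - z' x) :=
  ⟨h.prim.sub hz.prim, (h.prim'.sub hz.prim').congr_right fun x _ => by ring⟩

end General

lemma ofReal {q : ℝ → ℝ} {l : ℝ} {y y' : ℝ → ℝ} (h : IsSol q l y y') :
    IsSol q (l : ℂ) (fun x => (y x : ℂ)) (fun x => (y' x : ℂ)) :=
  ⟨h.prim.ofReal, h.prim'.ofReal.congr_right fun x _ => by simp⟩

lemma conj {q : ℝ → ℝ} {l : ℂ} {y y' : ℝ → ℂ} (h : IsSol q l y y') :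
    IsSol q (starRingEnd ℂ l) (fun x => starRingEnd ℂ (y x)) (fun x => starRingEnd ℂ (y' x)) :=
  ⟨h.prim.clm_comp Complex.conjCLE.toContinuousLinearMap,
    (h.prim'.clm_comp Complex.conjCLE.toContinuousLinearMap).congr_right fun x _ => by simp⟩

lemma re {q : ℝ → ℝ} {l : ℝ} {y y' : ℝ → ℂ} (h : IsSol q (l : ℂ) y y') :
    IsSol q l (fun x => (y x).re) (fun x => (y' x).re) :=
  ⟨h.prim.clm_comp Complex.reCLM, (h.prim'.clm_comp Complex.reCLM).congr_right fun x _ => by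
    simp⟩

end IsSol

/-- The Picard fixed point is complex valued; since `q`, `l` and the data are real, its real part
solves the same problem. -/
lemma exists_isSol {q : ℝ → ℝ} (hq : IntervalIntegrable q volume 0 1) (l c d : ℝ) :
    ∃ y y' : ℝ → ℝ, IsSol q l y y' ∧ y 1 = c ∧ y' 1 = d := by
  obtain ⟨Y, hY, -⟩ := existsUnique_picard hq (l : ℂ) (c : ℂ) (d : ℂ)
  have hYev : ∀ x ∈ Icc (0 : ℝ) 1, ev Y x = ((c : ℂ) + ∫ t in (1 : ℝ)..x, (ev Y t).2,
      (d : ℂ) + ∫ t in (1 : ℝ)..x, ((q t : ℂ) - l) * (ev Y t).1) := by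
    intro x hx
    rw [ev_of_mem Y hx]
    conv_lhs => rw [← hY]
    rfl
  have key : ∀ (f g : ℝ → ℂ) (e : ℂ), IntervalIntegrable g volume 0 1 →
      (∀ x ∈ Icc (0 : ℝ) 1, f x = e + ∫ t in (1 : ℝ)..x, g t) → IsPrimitive f g := by
    intro f g e hg hf
    refine .of_sub_eq hg fun x hx => ?_
    have h0 : (0 : ℝ) ∈ Icc (0 : ℝ) 1 := by simp
    have h1 : (1 : ℝ) ∈ Icc (0 : ℝ) 1 := by simp
    rw [hf x hx, hf 0 h0, ← intervalIntegral.integral_interval_sub_left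
      (intervalIntegrable_mono hg h1 hx) (intervalIntegrable_mono hg h1 h0)]
    ring
  have hs : IsSol q (l : ℂ) (fun x => (ev Y x).1) (fun x => (ev Y x).2) :=
    ⟨key _ _ c ((continuous_snd.comp (continuous_ev Y)).intervalIntegrable 0 1)
      fun x hx => congrArg Prod.fst (hYev x hx),
    key _ _ d (intervalIntegrable_potential_mul hq l
      (continuous_fst.comp (continuous_ev Y)).continuousOn)
      fun x hx => congrArg Prod.snd (hYev x hx)⟩
  refine ⟨_, _, hs.re, ?_, ?_⟩
  · simp [hYev 1 (by simp)]
  · simp [hYev 1 (by simp)]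

/-- The Picard construction starts at `1`. The combination `u(0) v - v(0) u` vanishes at `0`, and
its derivative there is the Wronskian of `u` and `v`, which equals `1` by its value at `1`. -/
lemma exists_isSol_at_zero {q : ℝ → ℝ} (hq : IntervalIntegrable q volume 0 1) (l : ℝ) :
    ∃ y y' : ℝ → ℝ, IsSol q l y y' ∧ y 0 = 0 ∧ y' 0 = 1 := by
  obtain ⟨u, u', hu, hu1, hu1'⟩ := exists_isSol hq l 1 0
  obtain ⟨v, v', hv, hv1, hv1'⟩ := exists_isSol hq l 0 1
  have hW := hu.wronskian_eq hv (a := 0) (b := 1) (by simp) (by simp)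
  rw [hu1, hu1', hv1, hv1'] at hW
  exact ⟨_, _, (hv.const_mul (u 0)).sub (hu.const_mul (v 0)), by ring, by linarith⟩

lemma exists_fundamental_isSol {q : ℝ → ℝ} (hq : IntervalIntegrable q volume 0 1) (l : ℝ) :
    ∃ u u' v v' : ℝ → ℝ, IsSol q l u u' ∧ IsSol q l v v' ∧
      ∀ x ∈ Icc (0 : ℝ) 1, u x * v' x - u' x * v x = 1 := by
  obtain ⟨u, u', hu, hu1, hu1'⟩ := exists_isSol hq l 1 0
  obtain ⟨v, v', hv, hv1, hv1'⟩ := exists_isSol hq l 0 1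
  refine ⟨u, u', v, v', hu, hv, fun x hx => ?_⟩
  rw [hu.wronskian_eq hv hx (b := 1) (by simp), hu1, hu1', hv1, hv1']
  ring

/-- A solution with vanishing Cauchy data at some point is trivial. -/
lemma IsSol.eq_zero {q : ℝ → ℝ} (hq : IntervalIntegrable q volume 0 1)
    {l : ℝ} {y y' : ℝ → ℂ} (h : IsSol q (l : ℂ) y y') {a : ℝ} (ha : a ∈ Icc (0 : ℝ) 1)
    (h0 : y a = 0) (h0' : y' a = 0) : ∀ x ∈ Icc (0 : ℝ) 1, y x = 0 ∧ y' x = 0 := by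
  obtain ⟨u, u', v, v', hu, hv, hW⟩ := exists_fundamental_isSol hq l
  intro x hx
  have h1 := h.wronskian_eq hu.ofReal ha hx
  have h2 := h.wronskian_eq hv.ofReal ha hx
  have h3 : (u x : ℂ) * v' x - u' x * v x = 1 := by exact_mod_cast hW x hx
  rw [h0, h0'] at h1 h2
  -- Both Wronskians of `y`, with `u` and with `v`, vanish at `a` and so at `x`. This is a
  -- homogeneous linear system for `(y x, y' x)` with determinant `1`.
  constructor
  · linear_combination (-y x) * h3 + v x * h1 - u x * h2
  · linear_combination (-y' x) * h3 + v' x * h1 - u' x * h2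

lemma IsSol.eq_zero_real {q : ℝ → ℝ} (hq : IntervalIntegrable q volume 0 1)
    {l : ℝ} {y y' : ℝ → ℝ} (h : IsSol q l y y') {a : ℝ} (ha : a ∈ Icc (0 : ℝ) 1)
    (h0 : y a = 0) (h0' : y' a = 0) : ∀ x ∈ Icc (0 : ℝ) 1, y x = 0 ∧ y' x = 0 := by
  intro x hx
  exact_mod_cast h.ofReal.eq_zero hq ha (by simp [h0]) (by simp [h0']) x hx

/-! ### Continuous dependence on the energy -/

lemma exists_forall_abs_le {f : ℝ → ℝ} (hf : ContinuousOn f (Icc 0 1)) :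
    ∃ B, ∀ x ∈ Icc (0 : ℝ) 1, |f x| ≤ B := by
  obtain ⟨B, hB⟩ := isCompact_Icc.exists_bound_of_continuousOn hf
  exact ⟨B, hB⟩

/-- Variation of constants through the Lagrange identity: with `u`, `v` a fundamental system at
energy `m`, the difference is `z - y = (l - m) (Q u - P v)`, where `P` and `Q` are the integrals of
`z u` and `z v` from `c`. The unknown maximum of `|z|` on the right is absorbed when `|l - m|` is
small. -/
lemma IsSol.exists_abs_sub_le {q : ℝ → ℝ} (hq : IntervalIntegrable q volume 0 1) {m : ℝ}
    {y y' : ℝ → ℝ} (hy : IsSol q m y y') {c : ℝ} (hc : c ∈ Icc (0 : ℝ) 1) :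
    ∃ C δ : ℝ, 0 ≤ C ∧ 0 < δ ∧ ∀ (l : ℝ) (z z' : ℝ → ℝ), IsSol q l z z' → z c = y c → z' c = y' c →
      |l - m| ≤ δ → ∀ x ∈ Icc (0 : ℝ) 1, |z x - y x| ≤ C * |l - m| ∧ |z' x - y' x| ≤ C * |l - m| := by
  obtain ⟨u, u', v, v', hu, hv, hW⟩ := exists_fundamental_isSol hq m
  obtain ⟨B₁, hB₁⟩ := exists_forall_abs_le hu.continuousOn
  obtain ⟨B₂, hB₂⟩ := exists_forall_abs_le hu.continuousOn'
  obtain ⟨B₃, hB₃⟩ := exists_forall_abs_le hv.continuousOn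
  obtain ⟨B₄, hB₄⟩ := exists_forall_abs_le hv.continuousOn'
  obtain ⟨B₅, hB₅⟩ := exists_forall_abs_le hy.continuousOn
  obtain ⟨B, hB, h1, h2, h3, h4, h5⟩ : ∃ B : ℝ, 0 < B ∧ B₁ ≤ B ∧ B₂ ≤ B ∧ B₃ ≤ B ∧ B₄ ≤ B ∧
      B₅ ≤ B :=
    ⟨1 + |B₁| + |B₂| + |B₃| + |B₄| + |B₅|, by positivity, by grind, by grind, by grind, by grind,
      by grind⟩
  -- For `|l - m| ≤ 1 / (4B²)` the factor `2B² |l - m|` is at most `1/2`, which gives `max |z| ≤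
  -- 2B`; inserting this back produces `2B² · 2B = 4B³`.
  refine ⟨4 * B ^ 3, 1 / (4 * B ^ 2), by positivity, by positivity, ?_⟩
  intro l z z' hz hzc hzc' hl
  obtain ⟨x₀, hx₀, hmax⟩ := isCompact_Icc.exists_isMaxOn (nonempty_Icc.mpr zero_le_one)
    hz.continuousOn.abs
  have hM : ∀ x ∈ Icc (0 : ℝ) 1, |z x| ≤ |z x₀| := fun x hx => hmax hx
  have hint : ∀ w : ℝ → ℝ, (∀ x ∈ Icc (0 : ℝ) 1, |w x| ≤ B) → ∀ x ∈ Icc (0 : ℝ) 1,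
      |∫ t in c..x, z t * w t| ≤ |z x₀| * B := by
    intro w hw x hx
    have hle := intervalIntegral.norm_integral_le_of_norm_le_const (a := c) (b := x)
      (f := fun t => z t * w t) (C := |z x₀| * B) fun t ht => by
        have ht' : t ∈ Icc (0 : ℝ) 1 :=
          (uIcc_subset_Icc hc hx) (uIoc_subset_uIcc ht)
        rw [Real.norm_eq_abs, abs_mul]
        exact mul_le_mul (hM t ht') (hw t ht') (abs_nonneg _) (abs_nonneg _)
    refine hle.trans (mul_le_of_le_one_right (by positivity) ?_)
    rw [abs_le]
    constructor <;> linarith [hc.1, hc.2, hx.1, hx.2]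
  have key : ∀ x ∈ Icc (0 : ℝ) 1, |z x - y x| ≤ 2 * B ^ 2 * |z x₀| * |l - m| ∧
      |z' x - y' x| ≤ 2 * B ^ 2 * |z x₀| * |l - m| := by
    intro x hx
    have e1 := hz.lagrange hu hc hx
    have e2 := hz.lagrange hv hc hx
    have e3 := hy.wronskian_eq hu hc hx
    have e4 := hy.wronskian_eq hv hc hx
    rw [hzc, hzc', e3] at e1
    rw [hzc, hzc', e4] at e2
    have i1 := hint u (fun t ht => (hB₁ t ht).trans h1) x hx
    have i2 := hint v (fun t ht => (hB₃ t ht).trans h3) x hx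
    have hWx := hW x hx
    set P := ∫ t in c..x, z t * u t
    set Q := ∫ t in c..x, z t * v t
    have aux : ∀ a b : ℝ, |a| ≤ B → |b| ≤ B →
        |(l - m) * (Q * a - P * b)| ≤ 2 * B ^ 2 * |z x₀| * |l - m| := by
      intro a b ha hb
      have : |Q * a - P * b| ≤ |z x₀| * B * B + |z x₀| * B * B := by
        refine (abs_sub _ _).trans ?_
        rw [abs_mul, abs_mul]
        gcongr
      rw [abs_mul]
      nlinarith [mul_le_mul_of_nonneg_left this (abs_nonneg (l - m))]
    constructor
    · rw [show z x - y x = (l - m) * (Q * u x - P * v x) by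
        linear_combination (-(z x - y x)) * hWx + u x * e2 - v x * e1]
      exact aux _ _ ((hB₁ x hx).trans h1) ((hB₃ x hx).trans h3)
    · rw [show z' x - y' x = (l - m) * (Q * u' x - P * v' x) by
        linear_combination (-(z' x - y' x)) * hWx + u' x * e2 - v' x * e1]
      exact aux _ _ ((hB₂ x hx).trans h2) ((hB₄ x hx).trans h4)
  have hMle : |z x₀| ≤ 2 * B := by
    have a1 := (key x₀ hx₀).1
    have a2 := (hB₅ x₀ hx₀).trans h5
    have a3 : |z x₀| ≤ |z x₀ - y x₀| + |y x₀| := by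
      simpa using abs_add_le (z x₀ - y x₀) (y x₀)
    have a4 : 2 * B ^ 2 * |z x₀| * |l - m| ≤ 2 * B ^ 2 * |z x₀| * (1 / (4 * B ^ 2)) := by gcongr
    have a5 : 2 * B ^ 2 * |z x₀| * (1 / (4 * B ^ 2)) = |z x₀| / 2 := by field_simp; ring
    linarith
  have fin : 2 * B ^ 2 * |z x₀| * |l - m| ≤ 4 * B ^ 3 * |l - m| := by
    have : 2 * B ^ 2 * |z x₀| ≤ 2 * B ^ 2 * (2 * B) := by gcongr
    calc _ ≤ 2 * B ^ 2 * (2 * B) * |l - m| := by gcongr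
      _ = _ := by ring
  exact fun x hx => ⟨(key x hx).1.trans fin, (key x hx).2.trans fin⟩

/-- A family of real solutions, indexed by the energy, with fixed Cauchy data at `c`. -/
structure IsSolFamily (q : ℝ → ℝ) (c : ℝ) (F F' : ℝ → ℝ → ℝ) : Prop where
  mem : c ∈ Icc (0 : ℝ) 1
  isSol : ∀ l, IsSol q l (F l) (F' l)
  eq : ∀ l m, F l c = F m c
  eq' : ∀ l m, F' l c = F' m c

lemma IsSolFamily.exists_abs_sub_le {q : ℝ → ℝ} (hq : IntervalIntegrable q volume 0 1) {c : ℝ}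
    {F F' : ℝ → ℝ → ℝ} (h : IsSolFamily q c F F') (m : ℝ) :
    ∃ C : ℝ, 0 ≤ C ∧ ∀ᶠ l in 𝓝 m, ∀ x ∈ Icc (0 : ℝ) 1,
      |F l x - F m x| ≤ C * |l - m| ∧ |F' l x - F' m x| ≤ C * |l - m| := by
  obtain ⟨C, δ, hC, hδ, H⟩ := (h.isSol m).exists_abs_sub_le hq h.mem
  refine ⟨C, hC, ?_⟩
  filter_upwards [Metric.closedBall_mem_nhds m hδ] with l hl
  exact H l _ _ (h.isSol l) (h.eq l m) (h.eq' l m) hl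

/-- Near `(m, x)` the value `F l t` differs from `F m t` by `O(|l - m|)` uniformly in `t`, and `F m`
is continuous. -/
lemma continuousOn_prod_of_abs_sub_le {F : ℝ → ℝ → ℝ} (hF : ∀ m, ContinuousOn (F m) (Icc 0 1))
    (h : ∀ m, ∃ C : ℝ, ∀ᶠ l in 𝓝 m, ∀ x ∈ Icc (0 : ℝ) 1, |F l x - F m x| ≤ C * |l - m|) :
    ContinuousOn (fun p : ℝ × ℝ => F p.1 p.2) (univ ×ˢ Icc 0 1) := by
  rintro ⟨m, x⟩ ⟨-, hx⟩
  obtain ⟨C, hC⟩ := h m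
  have t1 : Tendsto (fun p : ℝ × ℝ => F m p.2) (𝓝[univ ×ˢ Icc 0 1] (m, x)) (𝓝 (F m x)) := by
    refine (hF m x hx).tendsto.comp (tendsto_nhdsWithin_iff.mpr
      ⟨(continuous_snd.tendsto (m, x)).mono_left nhdsWithin_le_nhds, ?_⟩)
    filter_upwards [self_mem_nhdsWithin] with p hp using hp.2
  have t2 : Tendsto (fun p : ℝ × ℝ => F p.1 p.2 - F m p.2) (𝓝[univ ×ˢ Icc 0 1] (m, x)) (𝓝 0) := by
    have t3 : Tendsto (fun p : ℝ × ℝ => C * |p.1 - m|) (𝓝[univ ×ˢ Icc 0 1] (m, x)) (𝓝 0) := by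
      have : Continuous fun p : ℝ × ℝ => C * |p.1 - m| := by fun_prop
      have h0 := (this.tendsto (m, x)).mono_left (nhdsWithin_le_nhds (s := univ ×ˢ Icc (0 : ℝ) 1))
      simpa using h0
    refine squeeze_zero_norm' ?_ t3
    filter_upwards [self_mem_nhdsWithin,
      ((continuous_fst.tendsto (m, x)).mono_left nhdsWithin_le_nhds).eventually hC] with p hp hp'
    exact hp' p.2 hp.2
  have := t2.add t1
  simpa [ContinuousWithinAt] using this

lemma IsSolFamily.continuousOn_prod {q : ℝ → ℝ} (hq : IntervalIntegrable q volume 0 1) {c : ℝ}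
    {F F' : ℝ → ℝ → ℝ} (h : IsSolFamily q c F F') :
    ContinuousOn (fun p : ℝ × ℝ => F p.1 p.2) (univ ×ˢ Icc 0 1) :=
  continuousOn_prod_of_abs_sub_le (fun m => (h.isSol m).continuousOn) fun m => by
    obtain ⟨C, -, hC⟩ := h.exists_abs_sub_le hq m
    exact ⟨C, hC.mono fun l hl x hx => (hl x hx).1⟩

lemma IsSolFamily.continuousOn_prod' {q : ℝ → ℝ} (hq : IntervalIntegrable q volume 0 1) {c : ℝ}
    {F F' : ℝ → ℝ → ℝ} (h : IsSolFamily q c F F') :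
    ContinuousOn (fun p : ℝ × ℝ => F' p.1 p.2) (univ ×ˢ Icc 0 1) :=
  continuousOn_prod_of_abs_sub_le (fun m => (h.isSol m).continuousOn') fun m => by
    obtain ⟨C, -, hC⟩ := h.exists_abs_sub_le hq m
    exact ⟨C, hC.mono fun l hl x hx => (hl x hx).2⟩

lemma continuous_fst_of_continuousOn_prod {F : ℝ → ℝ → ℝ}
    (hF : ContinuousOn (fun p : ℝ × ℝ => F p.1 p.2) (univ ×ˢ Icc 0 1)) {x : ℝ}
    (hx : x ∈ Icc (0 : ℝ) 1) : Continuous fun l => F l x := by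
  rw [← continuousOn_univ]
  exact hF.comp (f := fun l : ℝ => (l, x)) (by fun_prop) fun l _ => ⟨mem_univ _, hx⟩

lemma exists_isSolFamily {q : ℝ → ℝ} (hq : IntervalIntegrable q volume 0 1) (c d : ℝ) :
    ∃ F F' : ℝ → ℝ → ℝ, IsSolFamily q 1 F F' ∧ ∀ l, F l 1 = c ∧ F' l 1 = d := by
  choose F F' h using fun l => exists_isSol hq l c d
  exact ⟨F, F', ⟨by simp, fun l => (h l).1, fun l m => by rw [(h l).2.1, (h m).2.1],
    fun l m => by rw [(h l).2.2, (h m).2.2]⟩, fun l => (h l).2⟩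

/-- The family of real solutions `φ` with `φ 0 = 0` and `φ' 0 = 1`. -/
structure IsSineFamily (q : ℝ → ℝ) (φ φ' : ℝ → ℝ → ℝ) : Prop where
  isSol : ∀ l, IsSol q l (φ l) (φ' l)
  zero : ∀ l, φ l 0 = 0
  one : ∀ l, φ' l 0 = 1

lemma IsSineFamily.isSolFamily {q : ℝ → ℝ} {φ φ' : ℝ → ℝ → ℝ} (h : IsSineFamily q φ φ') :
    IsSolFamily q 0 φ φ' :=
  ⟨by simp, h.isSol, fun l m => by rw [h.zero, h.zero], fun l m => by rw [h.one, h.one]⟩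

lemma exists_isSineFamily {q : ℝ → ℝ} (hq : IntervalIntegrable q volume 0 1) :
    ∃ φ φ' : ℝ → ℝ → ℝ, IsSineFamily q φ φ' := by
  choose F F' h using fun l => exists_isSol_at_zero hq l
  exact ⟨F, F', ⟨fun l => (h l).1, fun l => (h l).2.1, fun l => (h l).2.2⟩⟩

end HalfLine

namespace HalfLine

/-! ### The Jost function through solutions on the unit interval -/

/-- The Wronskian of the Jost solution with `y` is constant: at `0` it equals the Jost function, at
`1` it is given by the explicit exponential. Only `k²` has to be real, so this covers both the real
momenta and the imaginary axis. -/
lemma jostFunction_eq {q : ℝ → ℝ} (hq : q ∈ PotentialClass 1) {k : ℂ} {l : ℝ} (hk : k ^ 2 = l)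
    {y y' : ℝ → ℝ} (hy : IsSol q l y y') (h0 : y 0 = 0) (h0' : y' 0 = 1) :
    jostFunction q k = Complex.exp (Complex.I * k) * (y' 1 - Complex.I * k * y 1) := by
  have hqi := intervalIntegrable_of_mem hq le_rfl zero_le_one
  obtain ⟨⟨f', hf⟩, hf1⟩ := isJostSolution_jostSolution hq k
  have hs := (hf.mono (Icc_subset_Ici_self : Icc (0 : ℝ) 1 ⊆ _)).isSol hqi
  rw [hk] at hs
  have e1 : jostSolution q k 1 = Complex.exp (Complex.I * k) := by simpa using hf1 1 le_rfl
  have e2 : f' 1 = Complex.I * k * Complex.exp (Complex.I * k) := by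
    have h1 : HasDerivWithinAt (jostSolution q k) (f' 1) (Ici 1) 1 :=
      (hf.hasDeriv 1 (by simp)).mono (Ici_subset_Ici.mpr zero_le_one)
    have h2 := (hasDerivAt_exp k 1).hasDerivWithinAt (s := Ici 1)
    have h3 := (uniqueDiffOn_Ici (1 : ℝ) 1 (by simp)).eq_deriv _ h1
      (h2.congr (fun x hx => hf1 x hx) (hf1 1 le_rfl))
    simpa using h3
  have hW := hs.wronskian_eq hy.ofReal (a := 0) (b := 1) (by simp) (by simp)
  rw [h0, h0', e1, e2] at hW
  simp only [Complex.ofReal_zero, Complex.ofReal_one] at hW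
  unfold jostFunction
  linear_combination hW

/-! ### Decaying solutions at negative energies -/

lemma isSol_exp (c : ℝ) :
    IsSol (fun _ => 0) (-c ^ 2) (fun x => Real.exp (c * x)) (fun x => c * Real.exp (c * x)) := by
  have hd : ∀ x : ℝ, HasDerivAt (fun x => Real.exp (c * x)) (c * Real.exp (c * x)) x := fun x => by
    simpa [mul_comm] using ((hasDerivAt_id x).const_mul c).exp
  refine ⟨.of_hasDerivWithinAt (fun x _ => (hd x).hasDerivWithinAt) (by fun_prop),
    .of_hasDerivWithinAt (fun x _ => ?_) (by fun_prop)⟩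
  refine (((hd x).const_mul c).hasDerivWithinAt).congr_deriv ?_
  simp only [RCLike.ofReal_zero]
  ring

lemma abs_integral_mul_le {q w : ℝ → ℝ} (hq : IntervalIntegrable q volume 0 1) {a b B : ℝ}
    (ha : 0 ≤ a) (hab : a ≤ b) (hb : b ≤ 1) (hB : 0 ≤ B) (hw : ∀ t ∈ Icc a b, |w t| ≤ B) :
    |∫ t in a..b, q t * w t| ≤ B * ∫ t in (0 : ℝ)..1, |q t| := by
  have ha' : a ∈ Icc (0 : ℝ) 1 := ⟨ha, hab.trans hb⟩
  have hb' : b ∈ Icc (0 : ℝ) 1 := ⟨ha.trans hab, hb⟩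
  have h1 : |∫ t in a..b, q t * w t| ≤ ∫ t in a..b, B * |q t| := by
    rw [← Real.norm_eq_abs]
    refine intervalIntegral.norm_integral_le_of_norm_le hab
      (Eventually.of_forall fun t ht => ?_)
      ((intervalIntegrable_mono hq ha' hb').abs.const_mul B)
    rw [Real.norm_eq_abs, abs_mul, mul_comm]
    exact mul_le_mul_of_nonneg_right (hw t (Ioc_subset_Icc_self ht)) (abs_nonneg _)
  refine h1.trans ?_
  rw [intervalIntegral.integral_const_mul]
  exact mul_le_mul_of_nonneg_left (intervalIntegral.integral_mono_interval ha hab hb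
    (Eventually.of_forall fun t => abs_nonneg _) hq.abs) hB

/-- At large negative energies the decaying solution has no zeros. -/
lemma IsSol.pos_of_large {q : ℝ → ℝ} (hq : IntervalIntegrable q volume 0 1) {κ : ℝ} (hκ : 0 < κ)
    (hκq : 3 * ∫ t in (0 : ℝ)..1, |q t| ≤ κ) {g g' : ℝ → ℝ} (hg : IsSol q (-κ ^ 2) g g')
    (h1 : g 1 = 1) (h1' : g' 1 = -κ) : ∀ x ∈ Icc (0 : ℝ) 1, 0 < g x := by
  set Q := ∫ t in (0 : ℝ)..1, |q t| with hQ
  have hQ0 : 0 ≤ Q := intervalIntegral.integral_nonneg zero_le_one fun t _ => abs_nonneg _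
  obtain ⟨x₀, hx₀, hmax⟩ := isCompact_Icc.exists_isMaxOn (nonempty_Icc.mpr zero_le_one)
    (hg.continuousOn.mul (f := g) (g := fun x => Real.exp (κ * x)) (by fun_prop)).abs
  set M := |g x₀ * Real.exp (κ * x₀)| with hMdef
  have hM : ∀ x ∈ Icc (0 : ℝ) 1, |g x * Real.exp (κ * x)| ≤ M := fun x hx => hmax hx
  have hM0 : 0 ≤ M := abs_nonneg _
  have hp := isSol_exp κ
  have hn := isSol_exp (-κ)
  have hone : (1 : ℝ) ∈ Icc (0 : ℝ) 1 := by simp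
  -- Comparing `g` with the free exponentials `exp(±κx)` gives `2κ (g exp(κx) - exp κ) = -I1 +
  -- exp(2κx) I2`. Each term on the right is at most `M Q` in modulus, and `3Q ≤ κ`.
  have key : ∀ x ∈ Icc (0 : ℝ) 1, |g x * Real.exp (κ * x) - Real.exp κ| ≤ M / 3 := by
    intro x hx
    have e1 := (hg.wronskian hp).sub_eq hx hone
    have e2 := (hg.wronskian hn).sub_eq hx hone
    have i1 : |∫ t in x..1, q t * (-(g t * Real.exp (κ * t)))| ≤ M * Q :=
      abs_integral_mul_le hq hx.1 hx.2 le_rfl hM0 fun t ht => by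
        rw [abs_neg]
        exact hM t ⟨hx.1.trans ht.1, ht.2⟩
    have i2 : |∫ t in x..1, q t * (-(g t * Real.exp (-κ * t)))| ≤
        (M * Real.exp (-2 * κ * x)) * Q :=
      abs_integral_mul_le hq hx.1 hx.2 le_rfl (by positivity) fun t ht => by
        have : g t * Real.exp (-κ * t) = g t * Real.exp (κ * t) * Real.exp (-2 * κ * t) := by
          rw [mul_assoc, ← Real.exp_add]
          ring_nf
        rw [abs_neg, this, abs_mul, Real.abs_exp]
        refine mul_le_mul (hM t ⟨hx.1.trans ht.1, ht.2⟩) (Real.exp_le_exp.mpr ?_)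
          (Real.exp_pos _).le hM0
        nlinarith [ht.1]
    have r1 : ∫ t in x..1, (((((0 : ℝ) : ℝ) : ℝ) - -κ ^ 2) - (q t - -κ ^ 2)) *
        (g t * Real.exp (κ * t)) = ∫ t in x..1, q t * (-(g t * Real.exp (κ * t))) :=
      intervalIntegral.integral_congr fun t _ => by ring
    have r2 : ∫ t in x..1, (((((0 : ℝ) : ℝ) : ℝ) - -(-κ) ^ 2) - (q t - -κ ^ 2)) *
        (g t * Real.exp (-κ * t)) = ∫ t in x..1, q t * (-(g t * Real.exp (-κ * t))) :=
      intervalIntegral.integral_congr fun t _ => by ring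
    simp only [RCLike.ofReal_real_eq_id, id_eq] at e1 e2
    rw [r1, h1, h1'] at e1
    rw [r2, h1, h1'] at e2
    set I1 := ∫ t in x..1, q t * (-(g t * Real.exp (κ * t)))
    set I2 := ∫ t in x..1, q t * (-(g t * Real.exp (-κ * t)))
    have hE : Real.exp (κ * x) * Real.exp (-κ * x) = 1 := by
      rw [← Real.exp_add]
      simp
    have hE2 : Real.exp (-2 * κ * x) = Real.exp (-κ * x) ^ 2 := by
      rw [← Real.exp_nat_mul]
      push_cast
      ring_nf
    have id : 2 * κ * (g x * Real.exp (κ * x) - Real.exp κ) = -I1 + Real.exp (κ * x) ^ 2 * I2 := by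
      rw [mul_one] at e1
      linear_combination (-1 : ℝ) * e1 + Real.exp (κ * x) ^ 2 * e2 -
        (Real.exp (κ * x) * (κ * g x + g' x)) * hE
    have i3 : |Real.exp (κ * x) ^ 2 * I2| ≤ M * Q := by
      rw [abs_mul, abs_of_nonneg (by positivity)]
      calc _ ≤ Real.exp (κ * x) ^ 2 * (M * Real.exp (-2 * κ * x) * Q) := by gcongr
        _ = (Real.exp (κ * x) * Real.exp (-κ * x)) ^ 2 * (M * Q) := by rw [hE2]; ring
        _ = M * Q := by rw [hE]; ring
    have i4 : 2 * κ * |g x * Real.exp (κ * x) - Real.exp κ| ≤ M * Q + M * Q := by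
      rw [← abs_of_pos (show 0 < 2 * κ by positivity), ← abs_mul, id]
      refine (abs_add_le _ _).trans (add_le_add ?_ i3)
      rwa [abs_neg]
    have i5 : M * (3 * Q) ≤ M * κ := mul_le_mul_of_nonneg_left hκq hM0
    nlinarith
  -- From `M ≤ M/3 + exp κ` one gets `M ≤ (3/2) exp κ`, so `g exp(κx)` stays within `exp κ / 2` of
  -- `exp κ`.
  have hM' : M ≤ 3 / 2 * Real.exp κ := by
    have a1 := key x₀ hx₀
    have a2 := abs_add_le (g x₀ * Real.exp (κ * x₀) - Real.exp κ) (Real.exp κ)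
    rw [sub_add_cancel, Real.abs_exp] at a2
    linarith
  intro x hx
  have a1 := (abs_le.mp (key x hx)).1
  have a2 := Real.exp_pos κ
  have : 0 < g x * Real.exp (κ * x) := by linarith
  exact (pos_iff_pos_of_mul_pos this).mpr (Real.exp_pos _)

/-- `G κ` is the solution at the energy `-κ²` which continues as `exp (-κ (x - 1))` for `x ≥ 1`. -/
structure IsDecayFamily (q : ℝ → ℝ) (G G' : ℝ → ℝ → ℝ) : Prop where
  isSol : ∀ κ, IsSol q (-κ ^ 2) (G κ) (G' κ)
  one : ∀ κ, G κ 1 = 1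
  one' : ∀ κ, G' κ 1 = -κ
  continuousOn : ContinuousOn (fun p : ℝ × ℝ => G p.1 p.2) (univ ×ˢ Icc 0 1)

lemma exists_isDecayFamily {q : ℝ → ℝ} (hq : IntervalIntegrable q volume 0 1) :
    ∃ G G' : ℝ → ℝ → ℝ, IsDecayFamily q G G' := by
  obtain ⟨U, U', hU, hU1⟩ := exists_isSolFamily hq 1 0
  obtain ⟨V, V', hV, hV1⟩ := exists_isSolFamily hq 0 1
  refine ⟨fun κ x => U (-κ ^ 2) x - κ * V (-κ ^ 2) x, fun κ x => U' (-κ ^ 2) x - κ * V' (-κ ^ 2) x,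
    fun κ => (hU.isSol _).sub ((hV.isSol _).const_mul κ), fun κ => ?_, fun κ => ?_, ?_⟩
  · simp [hU1, hV1]
  · simp [hU1, hV1]
  · have hm : ContinuousOn (fun p : ℝ × ℝ => (-p.1 ^ 2, p.2)) (univ ×ˢ Icc 0 1) := by fun_prop
    have hmaps : MapsTo (fun p : ℝ × ℝ => (-p.1 ^ 2, p.2)) (univ ×ˢ Icc 0 1) (univ ×ˢ Icc 0 1) :=
      fun p hp => ⟨mem_univ _, hp.2⟩
    exact ((hU.continuousOn_prod hq).comp hm hmaps).sub
      (continuousOn_fst.mul ((hV.continuousOn_prod hq).comp hm hmaps))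

/-- An interior zero of a nonnegative solution is a minimum, hence a double zero, and the Cauchy
data vanish there. -/
lemma IsSol.eq_zero_of_isMinOn {q : ℝ → ℝ} (hq : IntervalIntegrable q volume 0 1) {l : ℝ}
    {y y' : ℝ → ℝ} (h : IsSol q l y y') {x : ℝ} (hx : x ∈ Ioo (0 : ℝ) 1)
    (hmin : ∀ t ∈ Icc (0 : ℝ) 1, 0 ≤ y t) (h0 : y x = 0) :
    ∀ t ∈ Icc (0 : ℝ) 1, y t = 0 ∧ y' t = 0 := by
  have hn := Icc_mem_nhds hx.1 hx.2
  have hd := (h.prim.hasDerivWithinAt h.continuousOn' (Ioo_subset_Icc_self hx)).hasDerivAt hn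
  have hloc : IsLocalMin y x := by
    filter_upwards [hn] with t ht
    rw [h0]
    exact hmin t ht
  exact h.eq_zero_real hq (Ioo_subset_Icc_self hx) h0 (hloc.hasDerivAt_eq_zero hd)

/-- If positivity fails somewhere, take the largest `κ` at which `G κ` has a nonpositive value; it
exists by compactness, since large `κ` are covered by `IsSol.pos_of_large`. By continuity from
above, `G κ ≥ 0` with a zero. That zero is not at `0` by hypothesis and not at `1`, where the value
is `1`; so it is an interior double zero, which forces `G κ = 0`. -/
lemma IsDecayFamily.pos {q : ℝ → ℝ} (hq : IntervalIntegrable q volume 0 1) {G G' : ℝ → ℝ → ℝ}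
    (hG : IsDecayFamily q G G') (h0 : ∀ κ, 0 < κ → G κ 0 ≠ 0) :
    ∀ κ, 0 < κ → ∀ x ∈ Icc (0 : ℝ) 1, 0 < G κ x := by
  intro κ₀ hκ₀ y₀ hy₀
  by_contra hneg
  set K := max κ₀ (3 * ∫ t in (0 : ℝ)..1, |q t|) with hK
  have hlarge : ∀ κ, K ≤ κ → ∀ x ∈ Icc (0 : ℝ) 1, 0 < G κ x := fun κ hκ =>
    (hG.isSol κ).pos_of_large hq (hκ₀.trans_le ((le_max_left _ _).trans hκ))
      ((le_max_right _ _).trans hκ) (hG.one κ) (hG.one' κ)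
  set A : Set (ℝ × ℝ) := (Icc κ₀ K ×ˢ Icc 0 1) ∩ (fun p => G p.1 p.2) ⁻¹' Iic 0 with hA
  have hAc : IsCompact A := by
    refine (isCompact_Icc.prod isCompact_Icc).of_isClosed_subset ?_ inter_subset_left
    exact (hG.continuousOn.mono (prod_mono (subset_univ _) subset_rfl)).preimage_isClosed_of_isClosed
      (isClosed_Icc.prod isClosed_Icc) isClosed_Iic
  have hAn : A.Nonempty := ⟨(κ₀, y₀), ⟨⟨⟨le_rfl, le_max_left _ _⟩, hy₀⟩, not_lt.mp hneg⟩⟩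
  obtain ⟨⟨κ, x⟩, ⟨⟨hκ, hx⟩, hGle⟩, hmax⟩ := hAc.exists_isMaxOn hAn continuousOn_fst
  simp only at hκ hx
  have hGle : G κ x ≤ 0 := hGle
  have hκpos : 0 < κ := hκ₀.trans_le hκ.1
  have habove : ∀ k, κ < k → ∀ t ∈ Icc (0 : ℝ) 1, 0 < G k t := by
    intro k hk t ht
    rcases le_total K k with h | h
    · exact hlarge k h t ht
    · by_contra hc
      have : k ≤ κ := hmax (show (k, t) ∈ A from ⟨⟨⟨hκ.1.trans hk.le, h⟩, ht⟩, not_lt.mp hc⟩)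
      linarith
  have hnn : ∀ t ∈ Icc (0 : ℝ) 1, 0 ≤ G κ t := by
    intro t ht
    have hc : Continuous fun k => G k t := continuous_fst_of_continuousOn_prod hG.continuousOn ht
    refine ge_of_tendsto ((hc.tendsto κ).mono_left (nhdsWithin_le_nhds (s := Ioi κ))) ?_
    filter_upwards [self_mem_nhdsWithin] with k hk using (habove k hk t ht).le
  have hGx : G κ x = 0 := le_antisymm hGle (hnn x hx)
  have hx0 : x ≠ 0 := by
    rintro rfl
    exact h0 κ hκpos hGx
  have hx1 : x ≠ 1 := by
    rintro rfl
    rw [hG.one κ] at hGx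
    norm_num at hGx
  have := ((hG.isSol κ).eq_zero_of_isMinOn hq
    ⟨lt_of_le_of_ne hx.1 hx0.symm, lt_of_le_of_ne hx.2 hx1⟩ hnn hGx 1 (by simp)).1
  rw [hG.one κ] at this
  norm_num at this

/-- Picone's inequality. -/
lemma IsSol.picone {q : ℝ → ℝ} {l κ : ℝ} {y y' g g' : ℝ → ℝ} (hy : IsSol q l y y')
    (hy0 : y 0 = 0) (hg : IsSol q (-κ ^ 2) g g') (hpos : ∀ x ∈ Icc (0 : ℝ) 1, 0 < g x)
    (h1 : g 1 = 1) (h1' : g' 1 = -κ) :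
    0 ≤ y 1 * y' 1 + κ * y 1 ^ 2 + (l + κ ^ 2) * ∫ t in (0 : ℝ)..1, y t ^ 2 := by
  have hV := hy.wronskian hg
  have hz : IsPrimitive (fun x => y x / g x) (fun x => (y' x * g x - y x * g' x) / g x ^ 2) := by
    refine .of_hasDerivWithinAt (fun x hx => ?_) ?_
    · exact (hy.prim.hasDerivWithinAt hy.continuousOn' hx).div
        (hg.prim.hasDerivWithinAt hg.continuousOn' hx) (hpos x hx).ne'
    · refine ((hy.continuousOn'.mul hg.continuousOn).sub (hy.continuousOn.mul hg.continuousOn')).div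
        (hg.continuousOn.pow 2) fun x hx => (pow_pos (hpos x hx) 2).ne'
  have hR : ContinuousOn (fun x => ((y x * g' x - y' x * g x) / g x) ^ 2) (Icc 0 1) :=
    (((hy.continuousOn.mul hg.continuousOn').sub (hy.continuousOn'.mul hg.continuousOn)).div
      hg.continuousOn fun x hx => (hpos x hx).ne').pow 2
  -- With `V = y g' - y' g` one has `(y/g)' = -V/g²` and `V' = (l + κ²) y g`. Integrating `((y/g)
  -- V)'` writes the asserted quantity as `∫ (V/g)²`.
  have hP := ((hz.mul hV).congr_right (g := fun x => (l + κ ^ 2) * y x ^ 2 -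
      ((y x * g' x - y' x * g x) / g x) ^ 2) fun x hx => by
    have := (hpos x hx).ne'
    simp only [RCLike.ofReal_real_eq_id, id_eq]
    field_simp
    ring).sub_eq (a := 0) (b := 1) (by simp) (by simp)
  have hY : IntervalIntegrable (fun t => (l + κ ^ 2) * y t ^ 2) volume 0 1 :=
    (continuousOn_const.mul (hy.continuousOn.pow 2)).intervalIntegrable_of_Icc zero_le_one
  rw [intervalIntegral.integral_sub hY (hR.intervalIntegrable_of_Icc zero_le_one),
    intervalIntegral.integral_const_mul, hy0, h1, h1'] at hP
  have hnn : 0 ≤ ∫ x in (0 : ℝ)..1, ((y x * g' x - y' x * g x) / g x) ^ 2 :=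
    intervalIntegral.integral_nonneg zero_le_one fun x _ => sq_nonneg _
  simp only [zero_div, zero_mul, sub_zero, div_one, mul_one] at hP
  nlinarith

/-! ### Consequences of the absence of bound states -/

/-- What the absence of bound states gives for the solutions on the unit interval. -/
structure NoBoundState (q : ℝ → ℝ) (φ φ' : ℝ → ℝ → ℝ) : Prop where
  pos : ∀ x ∈ Ioc (0 : ℝ) 1, 0 < φ 0 x
  nonneg' : 0 ≤ φ' 0 1
  form_nonneg : ∀ (l : ℝ) (y y' : ℝ → ℝ), IsSol q l y y' → y 0 = 0 →
    0 ≤ y 1 * y' 1 + l * ∫ t in (0 : ℝ)..1, y t ^ 2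

/-- Since `ψ(iκ) = exp(-κ) G κ 0`, the hypothesis gives `G κ 0 ≠ 0` and hence `G κ > 0` for all `κ >
0`. This yields strict inequalities at energies `-κ²`; their limits as `κ → 0` are weak, and
uniqueness for the Cauchy problem restores positivity of `φ 0` on `(0, 1]`. -/
lemma noBoundState {q : ℝ → ℝ} (hq : q ∈ PotentialClassPlus 1) {φ φ' : ℝ → ℝ → ℝ}
    (hφ : IsSineFamily q φ φ') : NoBoundState q φ φ' := by
  have hqi := intervalIntegrable_of_mem hq.1 le_rfl zero_le_one
  obtain ⟨G, G', hG⟩ := exists_isDecayFamily hqi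
  have hW : ∀ κ, ∀ x ∈ Icc (0 : ℝ) 1,
      G κ x * φ' (-κ ^ 2) x - G' κ x * φ (-κ ^ 2) x = G κ 0 := fun κ x hx => by
    rw [(hG.isSol κ).wronskian_eq (hφ.isSol _) hx (b := 0) (by simp), hφ.zero, hφ.one]
    ring
  have hW1 : ∀ κ, φ' (-κ ^ 2) 1 + κ * φ (-κ ^ 2) 1 = G κ 0 := fun κ => by
    rw [← hW κ 1 (by simp), hG.one, hG.one']
    ring
  have hG0 : ∀ κ, 0 < κ → G κ 0 ≠ 0 := by
    intro κ hκ hzero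
    refine hq.2 (Complex.I * κ) (by simpa using hκ) ?_
    rw [jostFunction_eq hq.1 (l := -κ ^ 2) ?_ (hφ.isSol _) (hφ.zero _) (hφ.one _)]
    · have h1 : ((φ' (-κ ^ 2) 1 : ℝ) : ℂ) + κ * (φ (-κ ^ 2) 1 : ℝ) = 0 := by
        exact_mod_cast (hW1 κ).trans hzero
      rw [mul_eq_zero]
      right
      rw [← h1]
      linear_combination (-(κ : ℂ) * (φ (-κ ^ 2) 1 : ℝ)) * Complex.I_sq
    · rw [mul_pow, Complex.I_sq]
      push_cast
      ring
  have hpos := hG.pos hqi hG0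
  have hφneg : ∀ κ, 0 < κ → ∀ x ∈ Ioc (0 : ℝ) 1, 0 < φ (-κ ^ 2) x := by
    intro κ hκ x hx
    -- The derivative of `φ / G` is the constant Wronskian `G κ 0` over `G²`, so the quotient
    -- increases from `0`.
    have hmono : StrictMonoOn (fun x => φ (-κ ^ 2) x / G κ x) (Icc 0 1) := by
      refine strictMonoOn_of_hasDerivWithinAt_pos (f' := fun x => G κ 0 / G κ x ^ 2)
        (convex_Icc 0 1) ((hφ.isSol _).continuousOn.div (hG.isSol κ).continuousOn
          fun x hx => (hpos κ hκ x hx).ne') (fun t ht => ?_) (fun t ht => ?_)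
      · rw [interior_Icc] at ht ⊢
        have ht' := Ioo_subset_Icc_self ht
        have hd := ((hφ.isSol (-κ ^ 2)).prim.hasDerivWithinAt (hφ.isSol _).continuousOn' ht').div
          ((hG.isSol κ).prim.hasDerivWithinAt (hG.isSol κ).continuousOn' ht')
          (hpos κ hκ t ht').ne'
        refine (hd.mono Ioo_subset_Icc_self).congr_deriv ?_
        rw [← hW κ t ht']
        ring
      · rw [interior_Icc] at ht
        have := hpos κ hκ 0 (by simp)
        have := hpos κ hκ t (Ioo_subset_Icc_self ht)
        positivity
    have := hmono (by simp) (Ioc_subset_Icc_self hx) hx.1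
    simp only [hφ.zero, zero_div] at this
    exact (div_pos_iff_of_pos_right (hpos κ hκ x (Ioc_subset_Icc_self hx))).mp this
  have htend : Tendsto (fun κ : ℝ => -κ ^ 2) (𝓝[>] 0) (𝓝 0) := by
    have : Continuous fun κ : ℝ => -κ ^ 2 := by fun_prop
    simpa using (this.tendsto 0).mono_left (nhdsWithin_le_nhds (s := Ioi 0))
  have hcφ : ∀ x ∈ Icc (0 : ℝ) 1, Tendsto (fun κ : ℝ => φ (-κ ^ 2) x) (𝓝[>] 0) (𝓝 (φ 0 x)) :=
    fun x hx => ((continuous_fst_of_continuousOn_prod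
      (hφ.isSolFamily.continuousOn_prod hqi) hx).tendsto 0).comp htend
  have hcφ' : Tendsto (fun κ : ℝ => φ' (-κ ^ 2) 1) (𝓝[>] 0) (𝓝 (φ' 0 1)) :=
    ((continuous_fst_of_continuousOn_prod
      (hφ.isSolFamily.continuousOn_prod' hqi) (by simp)).tendsto 0).comp htend
  have hid : Tendsto (fun κ : ℝ => κ) (𝓝[>] 0) (𝓝 0) := tendsto_id.mono_left nhdsWithin_le_nhds
  have hnn : ∀ x ∈ Icc (0 : ℝ) 1, 0 ≤ φ 0 x := by
    intro x hx
    rcases eq_or_lt_of_le hx.1 with rfl | h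
    · rw [hφ.zero]
    · refine ge_of_tendsto (hcφ x hx) ?_
      filter_upwards [self_mem_nhdsWithin] with κ hκ using (hφneg κ hκ x ⟨h, hx.2⟩).le
  have hnn' : 0 ≤ φ' 0 1 := by
    have ht := hcφ'.add (hid.mul (hcφ 1 (by simp)))
    rw [zero_mul, add_zero] at ht
    refine ge_of_tendsto ht ?_
    filter_upwards [self_mem_nhdsWithin] with κ hκ
    rw [hW1]
    exact (hpos κ hκ 0 (by simp)).le
  have hnontriv : ∀ x ∈ Icc (0 : ℝ) 1, ¬ (φ 0 x = 0 ∧ φ' 0 x = 0) := by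
    rintro x hx ⟨h1, h2⟩
    have := ((hφ.isSol 0).eq_zero_real hqi hx h1 h2 0 (by simp)).2
    rw [hφ.one] at this
    norm_num at this
  refine ⟨fun x hx => ?_, hnn', fun l y y' hy hy0 => ?_⟩
  · refine lt_of_le_of_ne (hnn x (Ioc_subset_Icc_self hx)) fun h0 => ?_
    rcases eq_or_lt_of_le hx.2 with rfl | h1
    -- If `φ 0` vanished at the endpoint `1`, nonnegativity would give `φ' 0 1 ≤ 0` from the left
    -- slopes; with `0 ≤ φ' 0 1` both Cauchy data would vanish.
    · have hd := ((hφ.isSol 0).prim.hasDerivWithinAt (hφ.isSol 0).continuousOn'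
        (x := 1) (by simp)).mono (Ico_subset_Icc_self : Ico (0 : ℝ) 1 ⊆ _)
      rw [hasDerivWithinAt_iff_tendsto_slope' (by simp)] at hd
      have : (𝓝[Ico (0 : ℝ) 1] 1).NeBot := by
        rw [nhdsWithin_Ico_eq_nhdsLT zero_lt_one]
        infer_instance
      have hle : φ' 0 1 ≤ 0 := by
        refine le_of_tendsto hd ?_
        filter_upwards [self_mem_nhdsWithin] with t ht
        rw [slope_def_field, ← h0, sub_zero]
        exact div_nonpos_of_nonneg_of_nonpos (hnn t (Ico_subset_Icc_self ht)) (by linarith [ht.2])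
      exact hnontriv 1 (by simp) ⟨h0.symm, le_antisymm hle hnn'⟩
    · exact hnontriv x ⟨hx.1.le, h1.le⟩
        ((hφ.isSol 0).eq_zero_of_isMinOn hqi ⟨hx.1, h1⟩ hnn h0.symm x ⟨hx.1.le, h1.le⟩)
  · have ht : Tendsto (fun κ : ℝ => y 1 * y' 1 + κ * y 1 ^ 2 +
        (l + κ ^ 2) * ∫ t in (0 : ℝ)..1, y t ^ 2) (𝓝[>] 0)
        (𝓝 (y 1 * y' 1 + l * ∫ t in (0 : ℝ)..1, y t ^ 2)) := by
      have : Continuous fun κ : ℝ => y 1 * y' 1 + κ * y 1 ^ 2 +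
        (l + κ ^ 2) * ∫ t in (0 : ℝ)..1, y t ^ 2 := by fun_prop
      simpa using (this.tendsto 0).mono_left (nhdsWithin_le_nhds (s := Ioi 0))
    refine ge_of_tendsto ht ?_
    filter_upwards [self_mem_nhdsWithin] with κ hκ
    exact hy.picone hy0 (hG.isSol κ) (hpos κ hκ) (hG.one κ) (hG.one' κ)

end HalfLine

namespace HalfLine

/-! ### The Prüfer angle -/

/-- The density `y² / (y'² + k² y²)` of the Prüfer angle. -/
noncomputable def pruferDensity (y y' : ℝ → ℝ) (k x : ℝ) : ℝ :=
  y x ^ 2 / (y' x ^ 2 + k ^ 2 * y x ^ 2)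

/-- The Prüfer angle of a solution `y` at the energy `k²` with `y 0 = 0`. -/
noncomputable def pruferAngle (q y y' : ℝ → ℝ) (k x : ℝ) : ℝ :=
  k * x - k * ∫ t in (0 : ℝ)..x, q t * pruferDensity y y' k t

lemma pruferDensity_nonneg (y y' : ℝ → ℝ) (k x : ℝ) : 0 ≤ pruferDensity y y' k x := by
  unfold pruferDensity
  positivity

lemma sq_mul_pruferDensity_le_one (y y' : ℝ → ℝ) (k x : ℝ) :
    k ^ 2 * pruferDensity y y' k x ≤ 1 := by
  unfold pruferDensity
  rw [← mul_div_assoc]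
  exact div_le_one_of_le₀ (by nlinarith [sq_nonneg (y' x)]) (by positivity)

lemma abs_pruferDensity_le (y y' : ℝ → ℝ) {k : ℝ} (hk : k ≠ 0) (x : ℝ) :
    |pruferDensity y y' k x| ≤ 1 / k ^ 2 := by
  rw [abs_of_nonneg (pruferDensity_nonneg _ _ _ _), le_div_iff₀ (by positivity), mul_comm]
  exact sq_mul_pruferDensity_le_one y y' k x

lemma abs_mul_integral_pruferDensity_le {q : ℝ → ℝ} (hq : IntervalIntegrable q volume 0 1)
    (y y' : ℝ → ℝ) {k : ℝ} (hk : k ≠ 0) {x : ℝ} (hx : x ∈ Icc (0 : ℝ) 1) :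
    |k * ∫ t in (0 : ℝ)..x, q t * pruferDensity y y' k t| ≤ (∫ t in (0 : ℝ)..1, |q t|) / |k| := by
  have h := abs_integral_mul_le hq le_rfl hx.1 hx.2 (by positivity)
    fun t _ => abs_pruferDensity_le y y' hk t
  rw [abs_mul, le_div_iff₀ (abs_pos.mpr hk)]
  calc _ ≤ |k| * (1 / k ^ 2 * ∫ t in (0 : ℝ)..1, |q t|) * |k| := by gcongr
    _ = _ := by
      rw [← sq_abs k]
      have := abs_pos.mpr hk
      field_simp

namespace IsSol

variable {q y y' : ℝ → ℝ} {k : ℝ}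

lemma sq_add_sq_pos (hq : IntervalIntegrable q volume 0 1) (hk : k ≠ 0)
    {l : ℝ} (hy : IsSol q l y y') (h0' : y' 0 = 1) {x : ℝ} (hx : x ∈ Icc (0 : ℝ) 1) :
    0 < y' x ^ 2 + k ^ 2 * y x ^ 2 := by
  refine lt_of_le_of_ne (by positivity) fun h => ?_
  have h1 : y' x = 0 := by nlinarith [sq_nonneg (y' x), mul_nonneg (sq_nonneg k) (sq_nonneg (y x))]
  have h2 : y x = 0 := by
    have : k ^ 2 * y x ^ 2 = 0 := by rw [h1] at h; linarith
    simpa [hk] using this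
  have := (hy.eq_zero_real hq hx h2 h1 0 (by simp)).2
  rw [h0'] at this
  norm_num at this

lemma continuousOn_pruferDensity (hq : IntervalIntegrable q volume 0 1) (hk : k ≠ 0)
    {l : ℝ} (hy : IsSol q l y y') (h0' : y' 0 = 1) :
    ContinuousOn (pruferDensity y y' k) (Icc 0 1) :=
  (hy.continuousOn.pow 2).div ((hy.continuousOn'.pow 2).add
    (continuousOn_const.mul (hy.continuousOn.pow 2))) fun _ hx => (hy.sq_add_sq_pos hq hk h0' hx).ne'

lemma intervalIntegrable_mul_pruferDensity (hq : IntervalIntegrable q volume 0 1) (hk : k ≠ 0)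
    {l : ℝ} (hy : IsSol q l y y') (h0' : y' 0 = 1) :
    IntervalIntegrable (fun t => q t * pruferDensity y y' k t) volume 0 1 :=
  hq.mul_continuousOn (by
    rw [uIcc_of_le zero_le_one]
    exact hy.continuousOn_pruferDensity hq hk h0')

lemma isPrimitive_pruferAngle (hq : IntervalIntegrable q volume 0 1) (hk : k ≠ 0)
    {l : ℝ} (hy : IsSol q l y y') (h0' : y' 0 = 1) :
    IsPrimitive (pruferAngle q y y' k) (fun x => k - k * (q x * pruferDensity y y' k x)) := by
  have h1 : IsPrimitive (fun x : ℝ => k * x) (fun _ => k) :=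
    .of_hasDerivWithinAt (fun x _ => by
      simpa using ((hasDerivAt_id x).const_mul k).hasDerivWithinAt) continuousOn_const
  have h2 : IsPrimitive (fun x => ∫ t in (0 : ℝ)..x, q t * pruferDensity y y' k t)
      (fun t => q t * pruferDensity y y' k t) :=
    ⟨hy.intervalIntegrable_mul_pruferDensity hq hk h0', fun x _ => by simp⟩
  exact h1.sub (h2.const_mul k)

/-- Polar coordinates of `(y', k y)`. -/
lemma exists_prufer (hq : IntervalIntegrable q volume 0 1) (hk : k ≠ 0)
    (hy : IsSol q (k ^ 2) y y') (h0 : y 0 = 0) (h0' : y' 0 = 1) {x : ℝ}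
    (hx : x ∈ Icc (0 : ℝ) 1) :
    ∃ r : ℝ, 0 < r ∧ y' x = r * Real.cos (pruferAngle q y y' k x) ∧
      k * y x = r * Real.sin (pruferAngle q y y' k x) := by
  have hyc := hy.ofReal
  -- The function `w = y' + iky` satisfies `w' = ikw + qy` and has no zeros, so `w = exp L` with `L'
  -- = ik + q y/w` and `L(0) = 0`. Integrating the logarithmic derivative avoids any choice of
  -- branch.
  set w : ℝ → ℂ := fun x => (y' x : ℂ) + Complex.I * k * y x with hw
  have hwp : IsPrimitive w (fun x => Complex.I * k * w x + q x * y x) :=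
    (hyc.prim'.add (hyc.prim.const_mul (Complex.I * k))).congr_right fun x _ => by
      simp only [hw]
      push_cast
      linear_combination (-(k : ℂ) ^ 2 * y x) * Complex.I_sq
  have hwne : ∀ x ∈ Icc (0 : ℝ) 1, w x ≠ 0 := by
    intro x hx hzero
    have h1 := congrArg Complex.re hzero
    have h2 := congrArg Complex.im hzero
    simp [hw] at h1 h2
    have := hy.sq_add_sq_pos hq hk h0' hx
    rcases h2 with h2 | h2
    · exact hk h2
    · rw [h1, h2] at this
      norm_num at this
  set f : ℝ → ℂ := fun x => Complex.I * k + q x * (y x / w x) with hf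
  have hqc : IntervalIntegrable (fun t => (q t : ℂ)) volume 0 1 := by
    rw [intervalIntegrable_iff] at hq ⊢
    exact Integrable.ofReal hq
  have hfi : IntervalIntegrable f volume 0 1 := by
    refine intervalIntegrable_const.add (hqc.mul_continuousOn ?_)
    rw [uIcc_of_le zero_le_one]
    exact hyc.continuousOn.div hwp.continuousOn hwne
  have hL : IsPrimitive (fun x => ∫ t in (0 : ℝ)..x, f t) f := ⟨hfi, fun x _ => by simp⟩
  have hE := hwp.mul (hL.const_mul (-1)).cexp
  have hconst := hE.eq_of_zero (fun t ht => by
    have := hwne t ht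
    simp only [hf]
    field_simp
    ring) (a := 0) (b := x) (by simp) hx
  have hw0 : w 0 = 1 := by simp [hw, h0, h0']
  rw [hw0] at hconst
  simp only [intervalIntegral.integral_same, mul_zero, Complex.exp_zero, one_mul, neg_one_mul,
    Complex.exp_neg] at hconst
  set L := ∫ t in (0 : ℝ)..x, f t with hLdef
  have hwL : w x = Complex.exp L := by
    have := Complex.exp_ne_zero L
    field_simp at hconst
    exact hconst.symm
  -- Since `Im (y/w) = -k y² / (y'² + k² y²)`, the imaginary part of `L` is exactly the Prüfer
  -- angle.
  have him : L.im = pruferAngle q y y' k x := by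
    have h1 := (hL.clm_comp Complex.imCLM).eq_add x hx
    have h2 := (hy.isPrimitive_pruferAngle hq hk h0').eq_add x hx
    rw [h2]
    simp only [Complex.imCLM_apply, intervalIntegral.integral_same, Complex.zero_im] at h1
    rw [h1]
    congr 1
    · simp [pruferAngle]
    · refine intervalIntegral.integral_congr fun t ht => ?_
      rw [uIcc_of_le hx.1] at ht
      have hR := hy.sq_add_sq_pos hq hk h0' ⟨ht.1, ht.2.trans hx.2⟩
      have hn : Complex.normSq (w t) = y' t ^ 2 + k ^ 2 * y t ^ 2 := by
        rw [Complex.normSq_apply]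
        simp only [hw]
        simp
        ring
      have e : ((y t : ℂ) / w t).im = -(k * pruferDensity y y' k t) := by
        rw [Complex.div_im, hn, pruferDensity]
        simp only [hw]
        simp
        field_simp
      simp only [hf]
      rw [Complex.add_im, Complex.im_ofReal_mul, e]
      simp
      ring
  refine ⟨Real.exp L.re, Real.exp_pos _, ?_, ?_⟩
  · rw [← him, ← Complex.exp_re, ← hwL]
    simp [hw]
  · rw [← him, ← Complex.exp_im, ← hwL]
    simp [hw]

end IsSol

/-! ### The phase shift -/

/-- The phase shift, in terms of the solutions `φ (k²)`. -/
noncomputable def phase (q : ℝ → ℝ) (φ φ' : ℝ → ℝ → ℝ) (k : ℝ) : ℝ :=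
  -- The value at `0` is chosen as the limit from the right: `k - ξ(k)` tends to `π/2` when `φ' 0 1
  -- = 0` and to `0` otherwise.
  if k = 0 then (if φ' 0 1 = 0 then -(Real.pi / 2) else 0)
  else k * ∫ t in (0 : ℝ)..1, q t * pruferDensity (φ (k ^ 2)) (φ' (k ^ 2)) k t

section Phase

variable {q : ℝ → ℝ} {φ φ' : ℝ → ℝ → ℝ}

lemma phase_of_ne {k : ℝ} (hk : k ≠ 0) : phase q φ φ' k =
    k * ∫ t in (0 : ℝ)..1, q t * pruferDensity (φ (k ^ 2)) (φ' (k ^ 2)) k t := if_neg hk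

lemma pruferAngle_one {k : ℝ} (hk : k ≠ 0) :
    pruferAngle q (φ (k ^ 2)) (φ' (k ^ 2)) k 1 = k - phase q φ φ' k := by
  rw [phase_of_ne hk, pruferAngle, mul_one]

lemma phase_neg {k : ℝ} (hk : k ≠ 0) : phase q φ φ' (-k) = -phase q φ φ' k := by
  rw [phase_of_ne hk, phase_of_ne (neg_ne_zero.mpr hk), neg_sq]
  simp only [pruferDensity, neg_sq]
  ring

lemma abs_phase_le (hq : IntervalIntegrable q volume 0 1) {k : ℝ} (hk : k ≠ 0) :
    |phase q φ φ' k| ≤ (∫ t in (0 : ℝ)..1, |q t|) / |k| := by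
  rw [phase_of_ne hk]
  exact abs_mul_integral_pruferDensity_le hq _ _ hk (by simp)

/-- Polar coordinates of `(φ' (k²) 1, k φ (k²) 1)`. -/
lemma IsSineFamily.exists_polar (hq : IntervalIntegrable q volume 0 1) (hφ : IsSineFamily q φ φ')
    {k : ℝ} (hk : k ≠ 0) :
    ∃ r : ℝ, 0 < r ∧ φ' (k ^ 2) 1 = r * Real.cos (k - phase q φ φ' k) ∧
      k * φ (k ^ 2) 1 = r * Real.sin (k - phase q φ φ' k) := by
  rw [← pruferAngle_one hk]
  exact (hφ.isSol _).exists_prufer hq hk (hφ.zero _) (hφ.one _) (by simp)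

/-- In polar coordinates `ψ(k) = exp(ik) r exp(-i(k - ξ)) = r exp(iξ)`, and likewise `ψ(-k) = r
exp(-iξ)` with the same `r`. -/
lemma scatteringMatrix_eq (hq : q ∈ PotentialClass 1) (hφ : IsSineFamily q φ φ') {k : ℝ}
    (hk : k ≠ 0) : scatteringMatrix q k = Complex.exp (-2 * Complex.I * phase q φ φ' k) := by
  obtain ⟨r, hr, hc, hs⟩ := hφ.exists_polar (intervalIntegrable_of_mem hq le_rfl zero_le_one) hk
  set ξ := phase q φ φ' k
  unfold scatteringMatrix
  rw [jostFunction_eq hq (k := k) (l := k ^ 2) (by push_cast; ring) (hφ.isSol _) (hφ.zero _)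
      (hφ.one _), jostFunction_eq hq (k := -k) (l := k ^ 2) (by push_cast; ring) (hφ.isSol _)
      (hφ.zero _) (hφ.one _)]
  have hc' : ((φ' (k ^ 2) 1 : ℝ) : ℂ) = r * Complex.cos (k - ξ) := by
    rw [hc]; push_cast; rfl
  have hs' : (k : ℂ) * (φ (k ^ 2) 1 : ℝ) = r * Complex.sin (k - ξ) := by
    rw [← Complex.ofReal_mul, hs]; push_cast; rfl
  have e1 : ((φ' (k ^ 2) 1 : ℝ) : ℂ) - Complex.I * k * (φ (k ^ 2) 1 : ℝ) =
      r * Complex.exp (-(k - ξ) * Complex.I) := by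
    rw [Complex.exp_mul_I, Complex.cos_neg, Complex.sin_neg, hc']
    linear_combination (-Complex.I) * hs'
  have e2 : ((φ' (k ^ 2) 1 : ℝ) : ℂ) - Complex.I * (-k) * (φ (k ^ 2) 1 : ℝ) =
      r * Complex.exp ((k - ξ) * Complex.I) := by
    rw [Complex.exp_mul_I, hc']
    linear_combination Complex.I * hs'
  have hrc : (r : ℂ) ≠ 0 := by exact_mod_cast hr.ne'
  rw [e1, e2, div_eq_iff (mul_ne_zero (Complex.exp_ne_zero _)
    (mul_ne_zero hrc (Complex.exp_ne_zero _)))]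
  calc _ = r * (Complex.exp (Complex.I * -k) * Complex.exp ((k - ξ) * Complex.I)) := by ring
    _ = r * (Complex.exp (-2 * Complex.I * ξ) *
        (Complex.exp (Complex.I * k) * Complex.exp (-(k - ξ) * Complex.I))) := by
      rw [← Complex.exp_add, ← Complex.exp_add, ← Complex.exp_add]
      ring_nf
    _ = _ := by ring

/-- Dominated convergence: near `k₀` the density is at most `1/k² ≤ 4/k₀²`, and it is continuous in
`k` because its denominator does not vanish. -/
lemma continuousOn_phase (hq : IntervalIntegrable q volume 0 1) (hφ : IsSineFamily q φ φ') :
    ContinuousOn (phase q φ φ') {0}ᶜ := by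
  intro k₀ hk₀
  have hk₀ : k₀ ≠ 0 := hk₀
  refine ContinuousAt.continuousWithinAt ?_
  have hev : ∀ᶠ k in 𝓝 k₀, k ≠ 0 := isOpen_ne.mem_nhds hk₀
  have hev2 : ∀ᶠ k in 𝓝 k₀, k₀ ^ 2 / 4 ≤ k ^ 2 := by
    have h1 : Tendsto (fun k : ℝ => k ^ 2) (𝓝 k₀) (𝓝 (k₀ ^ 2)) := (continuous_pow 2).tendsto _
    refine (h1.eventually (lt_mem_nhds (a := k₀ ^ 2 / 4) ?_)).mono fun k hk => hk.le
    have : 0 < k₀ ^ 2 := by positivity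
    linarith
  have main : ContinuousAt (fun k =>
      ∫ t in (0 : ℝ)..1, q t * pruferDensity (φ (k ^ 2)) (φ' (k ^ 2)) k t) k₀ := by
    refine intervalIntegral.continuousAt_of_dominated_interval (bound := fun t => 4 / k₀ ^ 2 * |q t|)
      ?_ ?_ (hq.abs.const_mul _) ?_
    · filter_upwards [hev] with k hk
      exact (intervalIntegrable_iff.mp
        ((hφ.isSol (k ^ 2)).intervalIntegrable_mul_pruferDensity hq hk (hφ.one _))).1
    · filter_upwards [hev, hev2] with k hk hk2
      refine Eventually.of_forall fun t _ => ?_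
      rw [Real.norm_eq_abs, abs_mul, mul_comm]
      refine mul_le_mul_of_nonneg_right ((abs_pruferDensity_le _ _ hk t).trans ?_) (abs_nonneg _)
      have h2 : 0 < k₀ ^ 2 := by positivity
      rw [div_le_div_iff₀ (by positivity) h2]
      linarith
    · refine Eventually.of_forall fun t ht => ?_
      rw [uIoc_of_le zero_le_one] at ht
      have ht' := Ioc_subset_Icc_self ht
      have c1 : Continuous fun k : ℝ => φ (k ^ 2) t := (continuous_fst_of_continuousOn_prod
        (hφ.isSolFamily.continuousOn_prod hq) ht').comp (continuous_pow 2)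
      have c2 : Continuous fun k : ℝ => φ' (k ^ 2) t := (continuous_fst_of_continuousOn_prod
        (hφ.isSolFamily.continuousOn_prod' hq) ht').comp (continuous_pow 2)
      unfold pruferDensity
      exact continuousAt_const.mul ((c1.pow 2).continuousAt.div
        ((c2.pow 2).add ((continuous_pow 2).mul (c1.pow 2))).continuousAt
        ((hφ.isSol (k₀ ^ 2)).sq_add_sq_pos hq hk₀ (hφ.one _) ht').ne')
  refine (continuousAt_id.mul main).congr ?_
  filter_upwards [hev] with k hk
  rw [phase_of_ne hk]
  rfl

lemma isBigO_phase (hq : IntervalIntegrable q volume 0 1) {F : Filter ℝ}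
    (hF : ∀ᶠ k in F, k ≠ 0) : phase q φ φ' =O[F] fun k : ℝ => k⁻¹ := by
  refine Asymptotics.IsBigO.of_bound (∫ t in (0 : ℝ)..1, |q t|) ?_
  filter_upwards [hF] with k hk
  rw [Real.norm_eq_abs, norm_inv, Real.norm_eq_abs, ← div_eq_mul_inv]
  exact abs_phase_le hq hk

end Phase

end HalfLine

namespace HalfLine

/-! ### Monotonicity of the Prüfer angle in the momentum -/

/-- Carathéodory's form of the derivative. Applied to factors `c` obtained from the Lagrange
identity, it dispenses with differentiating solutions in the energy. -/
lemma hasDerivAt_sub_mul_of_continuousAt {c : ℝ → ℝ} {x₀ : ℝ} (hc : ContinuousAt c x₀) :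
    HasDerivAt (fun x => (x - x₀) * c x) (c x₀) x₀ := by
  rw [hasDerivAt_iff_tendsto_slope]
  refine (hc.tendsto.mono_left nhdsWithin_le_nhds).congr' ?_
  filter_upwards [self_mem_nhdsWithin] with x hx
  have : x - x₀ ≠ 0 := sub_ne_zero.mpr hx
  rw [slope_def_field, sub_self, zero_mul, sub_zero, mul_div_cancel_left₀ _ this]

variable {q : ℝ → ℝ} {φ φ' : ℝ → ℝ → ℝ}

lemma IsSineFamily.exists_ne_zero (hφ : IsSineFamily q φ φ') (l : ℝ) :
    ∃ x ∈ Icc (0 : ℝ) 1, φ l x ≠ 0 := by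
  by_contra! h
  have h1 := (hφ.isSol l).prim.hasDerivWithinAt (hφ.isSol l).continuousOn' (x := 0) (by simp)
  have h2 := (hasDerivWithinAt_const (0 : ℝ) (Icc (0 : ℝ) 1) (0 : ℝ)).congr h (h 0 (by simp))
  have := (uniqueDiffOn_Icc_zero_one 0 (by simp)).eq_deriv _ h1 h2
  rw [hφ.one] at this
  norm_num at this

lemma integral_sq_pos {y : ℝ → ℝ} (hy : ContinuousOn y (Icc 0 1))
    (hne : ∃ x ∈ Icc (0 : ℝ) 1, y x ≠ 0) : 0 < ∫ t in (0 : ℝ)..1, y t ^ 2 := by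
  obtain ⟨c, hc, hcne⟩ := hne
  exact intervalIntegral.integral_pos zero_lt_one (hy.pow 2) (fun x _ => sq_nonneg _)
    ⟨c, hc, by positivity⟩

lemma IsSineFamily.integral_sq_pos (hφ : IsSineFamily q φ φ') (l : ℝ) :
    0 < ∫ t in (0 : ℝ)..1, φ l t ^ 2 :=
  HalfLine.integral_sq_pos (hφ.isSol l).continuousOn (hφ.exists_ne_zero l)

lemma IsSineFamily.continuousAt_integral_mul (hq : IntervalIntegrable q volume 0 1)
    (hφ : IsSineFamily q φ φ') (m : ℝ) :
    ContinuousAt (fun l => ∫ t in (0 : ℝ)..1, φ l t * φ m t) m := by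
  obtain ⟨C, hC0, hC⟩ := hφ.isSolFamily.exists_abs_sub_le hq m
  obtain ⟨B, hB⟩ := exists_forall_abs_le (hφ.isSol m).continuousOn
  have hB0 : 0 ≤ B := (abs_nonneg _).trans (hB 0 (by simp))
  rw [ContinuousAt, tendsto_iff_norm_sub_tendsto_zero]
  have h0 : Tendsto (fun l => C * |l - m| * B) (𝓝 m) (𝓝 0) := by
    have : Continuous fun l => C * |l - m| * B := by fun_prop
    simpa using this.tendsto m
  refine squeeze_zero' (Eventually.of_forall fun l => norm_nonneg _) ?_ h0
  filter_upwards [hC] with l hl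
  have hi : ∀ l, IntervalIntegrable (fun t => φ l t * φ m t) volume 0 1 := fun l =>
    ((hφ.isSol l).continuousOn.mul (hφ.isSol m).continuousOn).intervalIntegrable_of_Icc
      zero_le_one
  rw [← intervalIntegral.integral_sub (hi l) (hi m)]
  have := intervalIntegral.norm_integral_le_of_norm_le_const (a := 0) (b := 1)
    (f := fun t => φ l t * φ m t - φ m t * φ m t) (C := C * |l - m| * B) fun t ht => by
      rw [uIoc_of_le zero_le_one] at ht
      have ht' := Ioc_subset_Icc_self ht
      rw [← sub_mul, norm_mul]
      exact mul_le_mul (hl t ht').1 (hB t ht') (abs_nonneg _) (by positivity)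
  simpa using this

lemma IsSineFamily.continuous_one (hq : IntervalIntegrable q volume 0 1)
    (hφ : IsSineFamily q φ φ') : Continuous fun k : ℝ => φ (k ^ 2) 1 :=
  (continuous_fst_of_continuousOn_prod (hφ.isSolFamily.continuousOn_prod hq)
    (by simp)).comp (continuous_pow 2)

lemma IsSineFamily.continuous_one' (hq : IntervalIntegrable q volume 0 1)
    (hφ : IsSineFamily q φ φ') : Continuous fun k : ℝ => φ' (k ^ 2) 1 :=
  (continuous_fst_of_continuousOn_prod (hφ.isSolFamily.continuousOn_prod' hq)
    (by simp)).comp (continuous_pow 2)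

/-- The angle `k - ξ k` is differentiable for `k ≠ 0`, with positive derivative. -/
lemma exists_hasDerivAt_sub_phase (hq : IntervalIntegrable q volume 0 1)
    (hφ : IsSineFamily q φ φ') (hN : NoBoundState q φ φ') {k₀ : ℝ} (hk₀ : k₀ ≠ 0) :
    ∃ d : ℝ, 0 < d ∧ HasDerivAt (fun k => k - phase q φ φ' k) d k₀ := by
  set θ : ℝ → ℝ := fun k => k - phase q φ φ' k with hθ
  have hθc : ContinuousAt θ k₀ := continuousAt_id.sub
    ((continuousOn_phase hq hφ).continuousAt (isOpen_compl_singleton.mem_nhds hk₀))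
  set I : ℝ → ℝ := fun k => ∫ t in (0 : ℝ)..1, φ (k ^ 2) t * φ (k₀ ^ 2) t with hI
  have hIc : ContinuousAt I k₀ :=
    (hφ.continuousAt_integral_mul hq (k₀ ^ 2)).comp (f := fun k : ℝ => k ^ 2)
      (continuous_pow 2).continuousAt
  set den : ℝ → ℝ := fun k => φ' (k ^ 2) 1 * φ' (k₀ ^ 2) 1 +
    k * k₀ * (φ (k ^ 2) 1 * φ (k₀ ^ 2) 1) with hden
  have hdc : Continuous den := by
    have h1 := hφ.continuous_one hq
    have h2 := hφ.continuous_one' hq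
    exact (h2.mul_const _).add ((continuous_id.mul_const _).mul (h1.mul_const _))
  have hden0 : 0 < den k₀ := by
    have := (hφ.isSol (k₀ ^ 2)).sq_add_sq_pos hq hk₀ (hφ.one _) (x := 1) (by simp)
    simp only [hden]
    nlinarith
  -- The addition formulas and the Lagrange identity give `tan (θ k - θ k₀) = (k - k₀) c k`. The
  -- second summand of the numerator arises because the momenta `k` and `k₀` multiply the two terms
  -- of the Wronskian separately.
  set c : ℝ → ℝ := fun k => (k * (k + k₀) * I k + φ (k₀ ^ 2) 1 * φ' (k ^ 2) 1) / den k with hc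
  have hcc : ContinuousAt c k₀ :=
    (((continuousAt_id.mul (continuousAt_id.add continuousAt_const)).mul hIc).add
      (continuousAt_const.mul (hφ.continuous_one' hq).continuousAt)).div hdc.continuousAt hden0.ne'
  have hform := hN.form_nonneg (k₀ ^ 2) _ _ (hφ.isSol _) (hφ.zero _)
  have hsq := hφ.integral_sq_pos (k₀ ^ 2)
  have hI0 : I k₀ = ∫ t in (0 : ℝ)..1, φ (k₀ ^ 2) t ^ 2 := by simp only [hI, sq (φ _ _)]
  refine ⟨c k₀, ?_, ?_⟩
  · refine div_pos ?_ hden0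
    rw [hI0]
    -- The numerator at `k₀` is `2k₀² ∫ φ² + φ φ'`: one copy of `k₀² ∫ φ²` makes the quadratic form
    -- nonnegative, the other gives strict positivity.
    have : 0 < k₀ ^ 2 * ∫ t in (0 : ℝ)..1, φ (k₀ ^ 2) t ^ 2 := by positivity
    nlinarith
  · have hd := ((hasDerivAt_sub_mul_of_continuousAt hcc).arctan).add_const (θ k₀)
    simp only [sub_self, zero_mul] at hd
    refine (hd.congr_of_eventuallyEq ?_).congr_deriv (by norm_num)
    have e1 : ∀ᶠ k in 𝓝 k₀, |θ k - θ k₀| < Real.pi / 2 :=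
      (Metric.tendsto_nhds.mp hθc.tendsto) _ (by positivity)
    filter_upwards [e1, isOpen_ne.mem_nhds hk₀] with k hk hkne
    obtain ⟨r, hr, hcos, hsin⟩ := hφ.exists_polar hq hkne
    obtain ⟨r₀, hr₀, hcos₀, hsin₀⟩ := hφ.exists_polar hq hk₀
    have hL := (hφ.isSol (k ^ 2)).lagrange (hφ.isSol (k₀ ^ 2)) (a := 0) (b := 1) (by simp) (by simp)
    rw [hφ.zero, hφ.zero] at hL
    have s1 : r * r₀ * Real.sin (θ k - θ k₀) =
        (k - k₀) * (k * (k + k₀) * I k + φ (k₀ ^ 2) 1 * φ' (k ^ 2) 1) := by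
      rw [Real.sin_sub]
      calc _ = (r * Real.sin (θ k)) * (r₀ * Real.cos (θ k₀)) -
          (r * Real.cos (θ k)) * (r₀ * Real.sin (θ k₀)) := by ring
        _ = (k * φ (k ^ 2) 1) * φ' (k₀ ^ 2) 1 - φ' (k ^ 2) 1 * (k₀ * φ (k₀ ^ 2) 1) := by
          rw [hcos, hsin, hcos₀, hsin₀]
        _ = _ := by linear_combination k * hL
    have s2 : r * r₀ * Real.cos (θ k - θ k₀) = den k := by
      rw [Real.cos_sub]
      calc _ = (r * Real.cos (θ k)) * (r₀ * Real.cos (θ k₀)) +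
          (r * Real.sin (θ k)) * (r₀ * Real.sin (θ k₀)) := by ring
        _ = φ' (k ^ 2) 1 * φ' (k₀ ^ 2) 1 + (k * φ (k ^ 2) 1) * (k₀ * φ (k₀ ^ 2) 1) := by
          rw [hcos, hsin, hcos₀, hsin₀]
        _ = _ := by simp only [hden]; ring
    have hk' := abs_lt.mp hk
    have s3 : Real.tan (θ k - θ k₀) = (k - k₀) * c k := by
      rw [Real.tan_eq_sin_div_cos, ← mul_div_mul_left _ _ (mul_pos hr hr₀).ne', s1, s2, hc,
        mul_div_assoc]
    have s4 : Real.arctan ((k - k₀) * c k) = θ k - θ k₀ := by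
      rw [← s3, Real.arctan_tan (by linarith [hk'.1]) hk'.2]
    rw [s4]
    ring

/-! ### The behaviour at zero momentum -/

/-- Uniform closeness to energy `0` is used in two regions: on `[ε, 1]` the function `φ 0` is
bounded below by a positive minimum, while on `[0, ε]` its derivative exceeds `1/2`, so `φ l`
increases from `0`. -/
lemma NoBoundState.eventually_pos (hq : IntervalIntegrable q volume 0 1)
    (hφ : IsSineFamily q φ φ') (hN : NoBoundState q φ φ') :
    ∀ᶠ l in 𝓝 0, ∀ x ∈ Ioc (0 : ℝ) 1, 0 < φ l x := by
  obtain ⟨C, hC0, hC⟩ := hφ.isSolFamily.exists_abs_sub_le hq 0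
  have h1 : ∀ᶠ x in 𝓝[Icc 0 1] (0 : ℝ), 1 / 2 < φ' 0 x := by
    have := ((hφ.isSol 0).continuousOn' 0 (by simp)).tendsto
    rw [hφ.one] at this
    exact this.eventually (lt_mem_nhds (by norm_num))
  obtain ⟨ε, hε, hεd⟩ : ∃ ε : ℝ, ε ∈ Ioc (0 : ℝ) 1 ∧ ∀ x ∈ Icc 0 ε, 1 / 2 < φ' 0 x := by
    rw [nhdsWithin_Icc_eq_nhdsGE zero_lt_one] at h1
    obtain ⟨u, hu, hsub⟩ := mem_nhdsGE_iff_exists_Icc_subset.mp h1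
    have hu : 0 < u := hu
    refine ⟨min u 1, ⟨by positivity, min_le_right _ _⟩, fun x hx => hsub ?_⟩
    exact ⟨hx.1, hx.2.trans (min_le_left _ _)⟩
  obtain ⟨x₀, hx₀, hmin⟩ := isCompact_Icc.exists_isMinOn (nonempty_Icc.mpr hε.2)
    ((hφ.isSol 0).continuousOn.mono (Icc_subset_Icc_left hε.1.le))
  have hb : 0 < φ 0 x₀ := hN.pos x₀ ⟨hε.1.trans_le hx₀.1, hx₀.2⟩
  have h0 : Tendsto (fun l => C * |l - 0|) (𝓝 0) (𝓝 0) := by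
    have : Continuous fun l : ℝ => C * |l - 0| := by fun_prop
    simpa using this.tendsto 0
  filter_upwards [hC, h0.eventually (gt_mem_nhds hb), h0.eventually (gt_mem_nhds
    (show (0 : ℝ) < 1 / 2 by norm_num))] with l hl hl1 hl2 x hx
  rcases le_total ε x with h | h
  · have a1 := (abs_le.mp (hl x (Ioc_subset_Icc_self hx)).1).1
    have a2 : φ 0 x₀ ≤ φ 0 x := hmin ⟨h, hx.2⟩
    linarith
  · have hmono : StrictMonoOn (φ l) (Icc 0 ε) := by
      have hs : Icc 0 ε ⊆ Icc (0 : ℝ) 1 := Icc_subset_Icc_right hε.2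
      refine strictMonoOn_of_hasDerivWithinAt_pos (f' := φ' l) (convex_Icc 0 ε)
        ((hφ.isSol l).continuousOn.mono hs) (fun t ht => ?_) (fun t ht => ?_)
      · have ht' := interior_subset ht
        exact ((hφ.isSol l).prim.hasDerivWithinAt (hφ.isSol l).continuousOn' (hs ht')).mono
          (interior_subset.trans hs)
      · have ht' := interior_subset ht
        have a1 := (abs_le.mp (hl t (hs ht')).2).1
        have a2 := hεd t ht'
        linarith
    have := hmono ⟨le_rfl, hε.1.le⟩ ⟨hx.1.le, h⟩ hx.1
    rwa [hφ.zero] at this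

/-- A continuous path starting at `0` whose sine is positive afterwards cannot reach `±π`, and
within that strip a positive sine means an angle in `(0, π)`. -/
lemma mem_Ioo_of_sin_pos {f : ℝ → ℝ} (hf : ContinuousOn f (Icc 0 1)) (h0 : f 0 = 0)
    (hs : ∀ x ∈ Ioc (0 : ℝ) 1, 0 < Real.sin (f x)) : f 1 ∈ Ioo 0 Real.pi := by
  have hpi := Real.pi_pos
  have avoid : ∀ a, a ≠ 0 → Real.sin a = 0 → ∀ x ∈ Icc (0 : ℝ) 1, f x ≠ a := by
    rintro a ha hsin x hx rfl
    rcases eq_or_lt_of_le hx.1 with rfl | h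
    · exact ha h0
    · have := hs x ⟨h, hx.2⟩
      rw [hsin] at this
      exact lt_irrefl _ this
  have h1 := hs 1 (by simp)
  constructor
  · by_contra! hle
    have h2 : f 1 < -Real.pi := by
      by_contra! hge
      have := Real.sin_nonpos_of_nonpos_of_neg_pi_le hle hge
      linarith
    obtain ⟨x, hx, hfx⟩ := intermediate_value_Icc' zero_le_one hf
      (show -Real.pi ∈ Icc (f 1) (f 0) from ⟨h2.le, by rw [h0]; linarith⟩)
    exact avoid (-Real.pi) (by linarith) (by simp) x hx hfx
  · by_contra! hge
    obtain ⟨x, hx, hfx⟩ := intermediate_value_Icc zero_le_one hf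
      (show Real.pi ∈ Icc (f 0) (f 1) from ⟨by rw [h0]; linarith, hge⟩)
    exact avoid Real.pi (by linarith) (by simp) x hx hfx

/-- For small `k > 0` the solution is positive on `(0, 1]`, so its Prüfer angle at `1` lies in `(0,
π)`. There the angle is determined by its cotangent `φ' / (kφ)`, with no ambiguity modulo `π`. -/
lemma eventually_sub_phase_eq (hq : IntervalIntegrable q volume 0 1)
    (hφ : IsSineFamily q φ φ') (hN : NoBoundState q φ φ') :
    ∀ᶠ k in 𝓝[>] 0, 0 < φ (k ^ 2) 1 ∧ k - phase q φ φ' k =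
      Real.pi / 2 - Real.arctan (φ' (k ^ 2) 1 / (k * φ (k ^ 2) 1)) := by
  have ht : Tendsto (fun k : ℝ => k ^ 2) (𝓝[>] 0) (𝓝 0) := by
    simpa using ((continuous_pow 2).tendsto (0 : ℝ)).mono_left (nhdsWithin_le_nhds (s := Ioi 0))
  filter_upwards [ht.eventually (hN.eventually_pos hq hφ), self_mem_nhdsWithin] with k hk hk0
  have hk0 : 0 < k := hk0
  refine ⟨hk 1 (by simp), ?_⟩
  have hsol := hφ.isSol (k ^ 2)
  have hmem := mem_Ioo_of_sin_pos
    (hsol.isPrimitive_pruferAngle hq hk0.ne' (hφ.one _)).continuousOn (by simp [pruferAngle])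
    fun x hx => by
      obtain ⟨r, hr, -, hsin⟩ := hsol.exists_prufer hq hk0.ne' (hφ.zero _) (hφ.one _)
        (Ioc_subset_Icc_self hx)
      exact (pos_iff_pos_of_mul_pos (by rw [← hsin]; exact mul_pos hk0 (hk x hx))).mp hr
  rw [pruferAngle_one hk0.ne'] at hmem
  obtain ⟨r, hr, hcos, hsin⟩ := hφ.exists_polar hq hk0.ne'
  set θ := k - phase q φ φ' k
  rw [hcos, hsin, mul_div_mul_left _ _ hr.ne', ← Real.sin_pi_div_two_sub θ,
    ← Real.cos_pi_div_two_sub θ, ← Real.tan_eq_sin_div_cos,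
    Real.arctan_tan (by linarith [hmem.2]) (by linarith [hmem.1])]
  ring

/-- The angle `k - ξ k` has a positive one-sided derivative at `0`. -/
lemma exists_hasDerivWithinAt_sub_phase_zero (hq : IntervalIntegrable q volume 0 1)
    (hφ : IsSineFamily q φ φ') (hN : NoBoundState q φ φ') :
    ∃ d : ℝ, 0 < d ∧ HasDerivWithinAt (fun k => k - phase q φ φ' k) d (Ici 0) 0 := by
  have hb : 0 < φ 0 1 := hN.pos 1 (by simp)
  have hev := eventually_sub_phase_eq hq hφ hN
  have c1 := hφ.continuous_one hq
  have c2 := hφ.continuous_one' hq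
  have of_pos : ∀ h : ℝ → ℝ, h 0 = 0 - phase q φ φ' 0 →
      (∀ᶠ k in 𝓝[>] 0, k - phase q φ φ' k = h k) →
      (fun k => k - phase q φ φ' k) =ᶠ[𝓝[≥] 0] h := by
    intro h h0 hpos
    rw [← Ioi_insert, nhdsWithin_insert]
    exact eventually_sup.mpr ⟨h0.symm, hpos⟩
  by_cases ha : φ' 0 1 = 0
  -- Resonant case: the Lagrange identity with energy `0` gives `φ' (k²) 1 = -k² ∫ φ φ₀ / φ₀(1)`,
  -- where `φ₀ = φ 0`. So `φ' / (kφ) = k c(k)`, and the derivative of the angle at `0` is `-c 0 >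
  -- 0`.
  · set c : ℝ → ℝ := fun k => -(∫ t in (0 : ℝ)..1, φ (k ^ 2) t * φ 0 t) / (φ 0 1 * φ (k ^ 2) 1)
      with hc
    have hIc : ContinuousAt (fun k : ℝ => ∫ t in (0 : ℝ)..1, φ (k ^ 2) t * φ 0 t) 0 := by
      have h0 := hφ.continuousAt_integral_mul hq 0
      exact h0.comp_of_eq (f := fun k : ℝ => k ^ 2) (continuous_pow 2).continuousAt (by simp)
    have hcc : ContinuousAt c 0 := hIc.neg.div (continuous_const.mul c1).continuousAt
      (by simpa using hb.ne')
    have hd := ((hasDerivAt_sub_mul_of_continuousAt hcc).arctan).const_sub (Real.pi / 2)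
    have hsq := hφ.integral_sq_pos 0
    have hphase : phase q φ φ' 0 = -(Real.pi / 2) := by simp [phase, ha]
    refine ⟨-c 0, ?_, ?_⟩
    · have e : -c 0 = (∫ t in (0 : ℝ)..1, φ 0 t ^ 2) / (φ 0 1 * φ 0 1) := by
        simp [hc, sq, neg_div]
      rw [e]
      positivity
    · refine ((hd.hasDerivWithinAt (s := Ici 0)).congr_of_eventuallyEq
        (of_pos _ (by simp [hphase]) ?_) (by simp [hphase])).congr_deriv (by simp)
      filter_upwards [hev, self_mem_nhdsWithin] with k ⟨hk1, hk2⟩ hk0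
      have hk0 : 0 < k := hk0
      rw [hk2]
      congr 2
      have hL := (hφ.isSol (k ^ 2)).lagrange (hφ.isSol 0) (a := 0) (b := 1) (by simp) (by simp)
      rw [hφ.zero, hφ.zero, ha] at hL
      simp only [hc]
      field_simp
      linear_combination (-1 : ℝ) * hL
  · have ha' : 0 < φ' 0 1 := lt_of_le_of_ne hN.nonneg' (Ne.symm ha)
    -- Regular case: `π/2 - arctan (1/t) = arctan t` with `t = k φ / φ' = k c(k)`.
    set c : ℝ → ℝ := fun k => φ (k ^ 2) 1 / φ' (k ^ 2) 1 with hc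
    have hcc : ContinuousAt c 0 := c1.continuousAt.div c2.continuousAt (by simpa using ha)
    have hd := (hasDerivAt_sub_mul_of_continuousAt hcc).arctan
    have hphase : phase q φ φ' 0 = 0 := by simp [phase, ha]
    refine ⟨c 0, ?_, ?_⟩
    · have e : c 0 = φ 0 1 / φ' 0 1 := by simp [hc]
      rw [e]
      positivity
    · refine ((hd.hasDerivWithinAt (s := Ici 0)).congr_of_eventuallyEq
        (of_pos _ (by simp [hphase]) ?_) (by simp [hphase])).congr_deriv (by simp)
      have hev2 : ∀ᶠ k in 𝓝[>] (0 : ℝ), 0 < φ' (k ^ 2) 1 := by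
        have : Tendsto (fun k : ℝ => φ' (k ^ 2) 1) (𝓝[>] 0) (𝓝 (φ' 0 1)) := by
          simpa using (c2.tendsto 0).mono_left (nhdsWithin_le_nhds (s := Ioi 0))
        exact this.eventually (lt_mem_nhds ha')
      filter_upwards [hev, hev2, self_mem_nhdsWithin] with k ⟨hk1, hk2⟩ hk3 hk0
      have hk0 : 0 < k := hk0
      have hpos : 0 < k * φ (k ^ 2) 1 / φ' (k ^ 2) 1 := by positivity
      rw [hk2, ← inv_div (k * φ (k ^ 2) 1), Real.arctan_inv_of_pos hpos]
      simp only [hc, sub_zero, mul_div_assoc]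
      ring

/-- On `[0, ∞)` the phase is differentiable, one-sidedly at `0`, with derivative less than `1`. -/
lemma exists_hasDerivWithinAt_phase (hq : IntervalIntegrable q volume 0 1)
    (hφ : IsSineFamily q φ φ') (hN : NoBoundState q φ φ') {k : ℝ} (hk : 0 ≤ k) :
    ∃ d : ℝ, HasDerivWithinAt (phase q φ φ') d (Ici 0) k ∧ 0 < 1 - d := by
  obtain ⟨d, hd, h⟩ : ∃ d : ℝ, 0 < d ∧
      HasDerivWithinAt (fun k => k - phase q φ φ' k) d (Ici 0) k := by
    rcases eq_or_lt_of_le hk with rfl | hk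
    · exact exists_hasDerivWithinAt_sub_phase_zero hq hφ hN
    · obtain ⟨d, hd, h⟩ := exists_hasDerivAt_sub_phase hq hφ hN hk.ne'
      exact ⟨d, hd, h.hasDerivWithinAt⟩
  refine ⟨1 - d, ?_, by linarith⟩
  simpa using (hasDerivWithinAt_id k (Ici 0)).fun_sub h

lemma continuousOn_phase_Ici (hq : IntervalIntegrable q volume 0 1)
    (hφ : IsSineFamily q φ φ') (hN : NoBoundState q φ φ') :
    ContinuousOn (phase q φ φ') (Ici 0) := fun _ hk => by
  obtain ⟨d, hd, -⟩ := exists_hasDerivWithinAt_phase hq hφ hN hk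
  exact hd.continuousWithinAt

lemma strictMonoOn_sub_phase (hq : IntervalIntegrable q volume 0 1)
    (hφ : IsSineFamily q φ φ') (hN : NoBoundState q φ φ') :
    StrictMonoOn (fun k => k - phase q φ φ' k) (Ici 0) := by
  refine strictMonoOn_of_deriv_pos (convex_Ici 0)
    (continuousOn_id.sub (continuousOn_phase_Ici hq hφ hN)) fun k hk => ?_
  rw [interior_Ici] at hk
  obtain ⟨d, hd, h⟩ := exists_hasDerivAt_sub_phase hq hφ hN (ne_of_gt hk)
  rwa [h.deriv]

end HalfLine

namespace HalfLine

/-! ### Existence and uniqueness of the phase shift -/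

lemma isPhaseShift_phase {q : ℝ → ℝ} {φ φ' : ℝ → ℝ → ℝ} (hq : q ∈ PotentialClass 1)
    (hφ : IsSineFamily q φ φ') (hN : NoBoundState q φ φ') : IsPhaseShift q (phase q φ φ') := by
  have hqi := intervalIntegrable_of_mem hq le_rfl zero_le_one
  exact
    { continuousOn := continuousOn_phase hqi hφ
      odd := fun k hk => phase_neg hk
      exp_eq := fun k hk => scatteringMatrix_eq hq hφ hk
      isBigO_atTop := isBigO_phase hqi (eventually_ne_atTop 0)
      isBigO_atBot := isBigO_phase hqi (eventually_ne_atBot 0)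
      tendsto_right := (continuousOn_phase_Ici hqi hφ hN 0 (by simp)).mono_left
        (nhdsWithin_mono _ Ioi_subset_Ici_self) }

/-- The difference takes values in `πℤ`, so its modulus is `0` or exceeds `1`. On `(0, ∞)` it is
continuous and tends to `0`; a nonzero value would make the modulus attain `1`. Oddness and the
right limit handle `k ≤ 0`. -/
lemma IsPhaseShift.unique {q ξ η : ℝ → ℝ} (hξ : IsPhaseShift q ξ) (hη : IsPhaseShift q η) :
    ξ = η := by
  have hpi := Real.pi_gt_three
  have hlim : ∀ ζ : ℝ → ℝ, IsPhaseShift q ζ → Tendsto ζ atTop (𝓝 0) := fun ζ h =>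
    h.isBigO_atTop.trans_tendsto tendsto_inv_atTop_zero
  have hdisc : ∀ k : ℝ, k ≠ 0 → ξ k - η k = 0 ∨ 1 < |ξ k - η k| := by
    intro k hk
    have h1 : Complex.exp (-2 * Complex.I * ξ k - -2 * Complex.I * η k) = 1 := by
      rw [Complex.exp_sub, ← hξ.exp_eq k hk, ← hη.exp_eq k hk, div_self]
      rw [hη.exp_eq k hk]
      exact Complex.exp_ne_zero _
    obtain ⟨n, hn⟩ := Complex.exp_eq_one_iff.mp h1
    have h2 : ξ k - η k = -n * Real.pi := by
      have h3 : ((ξ k - η k : ℝ) : ℂ) = ((-n * Real.pi : ℝ) : ℂ) := by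
        have hI := Complex.I_ne_zero
        apply mul_left_cancel₀ (mul_ne_zero two_ne_zero hI)
        push_cast
        linear_combination (-1 : ℂ) * hn
      exact_mod_cast h3
    rcases eq_or_ne n 0 with rfl | hne
    · left
      simpa using h2
    · right
      have h4 : (1 : ℝ) ≤ |(n : ℝ)| := by exact_mod_cast Int.one_le_abs hne
      rw [h2, abs_mul, abs_neg, abs_of_pos Real.pi_pos]
      nlinarith
  have hpos : ∀ k, 0 < k → ξ k = η k := by
    intro k hk
    by_contra hne
    have hk1 : 1 < |ξ k - η k| := (hdisc k hk.ne').resolve_left (sub_ne_zero.mpr hne)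
    have ht : Tendsto (fun k => |ξ k - η k|) atTop (𝓝 0) := by
      simpa using ((hlim ξ hξ).sub (hlim η hη)).abs
    obtain ⟨K, hK1, hK0⟩ := ((ht.eventually (gt_mem_nhds one_pos)).and (eventually_gt_atTop 0)).exists
    have hc : ContinuousOn (fun k => |ξ k - η k|) (Ioi 0) :=
      ((hξ.continuousOn.sub hη.continuousOn).mono fun x hx => ne_of_gt hx).abs
    obtain ⟨x, hx, hx1⟩ := isPreconnected_Ioi.intermediate_value (show K ∈ Ioi 0 from hK0)
      (show k ∈ Ioi 0 from hk) hc ⟨hK1.le, hk1.le⟩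
    rcases hdisc x (ne_of_gt hx) with h | h
    · simp [h] at hx1
    · simp only at hx1
      rw [hx1] at h
      exact lt_irrefl _ h
  funext k
  rcases lt_trichotomy k 0 with hk | rfl | hk
  · have := hpos (-k) (by linarith)
    rw [hξ.odd k hk.ne, hη.odd k hk.ne] at this
    exact neg_injective this
  · refine tendsto_nhds_unique hξ.tendsto_right (hη.tendsto_right.congr' ?_)
    filter_upwards [self_mem_nhdsWithin] with k hk using (hpos k hk).symm
  · exact hpos k hk

section Spectrum

variable {q : ℝ → ℝ} {φ φ' : ℝ → ℝ → ℝ}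

/-! ### The quantization condition -/

lemma phase_zero_mem : phase q φ φ' 0 = 0 ∧ φ' 0 1 ≠ 0 ∨
    phase q φ φ' 0 = -(Real.pi / 2) ∧ φ' 0 1 = 0 := by
  by_cases h : φ' 0 1 = 0 <;> simp [phase, h]

lemma existsUnique_sub_phase_eq (hq : IntervalIntegrable q volume 0 1)
    (hφ : IsSineFamily q φ φ') (hN : NoBoundState q φ φ') {n : ℕ} (hn : 1 ≤ n) :
    ∃! k : ℝ, 0 ≤ k ∧ k - phase q φ φ' k = Real.pi / 2 * n := by
  have hpi := Real.pi_pos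
  have hn' : (1 : ℝ) ≤ n := by exact_mod_cast hn
  have hmono := strictMonoOn_sub_phase hq hφ hN
  set Q := ∫ t in (0 : ℝ)..1, |q t| with hQ
  have hQ0 : 0 ≤ Q := intervalIntegral.integral_nonneg zero_le_one fun t _ => abs_nonneg _
  -- As `K ≥ 1`, `|ξ(K)| ≤ Q`, so the angle at `K` exceeds `πn/2`.
  set K := Real.pi / 2 * n + Q + 1 with hK
  have hK1 : 1 ≤ K := by
    have : 0 ≤ Real.pi / 2 * n := by positivity
    linarith
  have h0 : 0 - phase q φ φ' 0 ≤ Real.pi / 2 * n := by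
    have : Real.pi / 2 ≤ Real.pi / 2 * n := le_mul_of_one_le_right (by positivity) hn'
    rcases phase_zero_mem (q := q) (φ := φ) (φ' := φ') with ⟨h, -⟩ | ⟨h, -⟩ <;> rw [h] <;> linarith
  have hKle : Real.pi / 2 * n ≤ K - phase q φ φ' K := by
    have h1 := abs_phase_le (φ := φ) (φ' := φ') hq (show K ≠ 0 by linarith)
    have h2 : Q / |K| ≤ Q := div_le_self hQ0 (hK1.trans (le_abs_self K))
    have h3 := (abs_le.mp h1).2
    linarith
  obtain ⟨k, hk, hkeq⟩ := intermediate_value_Icc (by linarith : (0 : ℝ) ≤ K)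
    ((continuousOn_id.sub (continuousOn_phase_Ici hq hφ hN)).mono Icc_subset_Ici_self)
    ⟨h0, hKle⟩
  have hkeq : k - phase q φ φ' k = Real.pi / 2 * n := hkeq
  exact ⟨k, ⟨hk.1, hkeq⟩, fun y hy => hmono.injOn hy.1 hk.1 (hy.2.trans hkeq.symm)⟩

/-! ### Eigenvalues -/

/-- Pairing `y` with its conjugate in the Lagrange identity gives `(l - conj l) ∫ |y|² = 0`. Then
`y` and `y'(0) φ r` have equal Cauchy data at `0`. The boundary hypothesis at `1` covers both the
Dirichlet and the Neumann condition. -/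
lemma IsSol.exists_real_of_selfAdjoint (hq : IntervalIntegrable q volume 0 1)
    (hφ : IsSineFamily q φ φ') {l : ℂ} {y y' : ℝ → ℂ} (hy : IsSol q l y y')
    (hne : ∃ x ∈ Icc (0 : ℝ) 1, y x ≠ 0) (h0 : y 0 = 0)
    (h1 : y 1 * starRingEnd ℂ (y' 1) - y' 1 * starRingEnd ℂ (y 1) = 0) :
    ∃ r : ℝ, l = r ∧ ∃ c : ℂ, c ≠ 0 ∧ y 1 = c * φ r 1 ∧ y' 1 = c * φ' r 1 := by
  obtain ⟨x₀, hx₀, hyx₀⟩ := hne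
  have hL := hy.lagrange hy.conj (a := 0) (b := 1) (by simp) (by simp)
  rw [h1, h0] at hL
  simp only [map_zero, mul_zero, zero_mul, sub_zero] at hL
  have hint : (∫ t in (0 : ℝ)..1, y t * starRingEnd ℂ (y t)) =
      ((∫ t in (0 : ℝ)..1, ‖y t‖ ^ 2 : ℝ) : ℂ) := by
    rw [← intervalIntegral.integral_ofReal]
    refine intervalIntegral.integral_congr fun t _ => ?_
    simp only [Complex.mul_conj, Complex.normSq_eq_norm_sq]
  have hpos : 0 < ∫ t in (0 : ℝ)..1, ‖y t‖ ^ 2 :=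
    integral_sq_pos hy.continuousOn.norm ⟨x₀, hx₀, by simpa using hyx₀⟩
  rw [hint] at hL
  have hl : l = starRingEnd ℂ l := by
    have h2 : ((∫ t in (0 : ℝ)..1, ‖y t‖ ^ 2 : ℝ) : ℂ) ≠ 0 := by exact_mod_cast hpos.ne'
    exact sub_eq_zero.mp ((mul_eq_zero.mp hL.symm).resolve_right h2)
  obtain ⟨r, rfl⟩ := Complex.conj_eq_iff_real.mp hl.symm
  have hz := (hy.sub ((hφ.isSol r).ofReal.const_mul (y' 0))).eq_zero hq (a := 0) (by simp)
    (by simp [h0, hφ.zero]) (by simp [hφ.one])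
  refine ⟨r, rfl, y' 0, fun hc => ?_, sub_eq_zero.mp (hz 1 (by simp)).1,
    sub_eq_zero.mp (hz 1 (by simp)).2⟩
  have := (hz x₀ hx₀).1
  rw [hc, zero_mul, sub_zero] at this
  exact hyx₀ this

lemma IsSineFamily.exists_ne_zero_ofReal (hφ : IsSineFamily q φ φ') (r : ℝ) :
    ∃ x ∈ Icc (0 : ℝ) 1, (φ r x : ℂ) ≠ 0 := by
  obtain ⟨x, hx, h⟩ := hφ.exists_ne_zero r
  exact ⟨x, hx, by exact_mod_cast h⟩

lemma mem_dirichletEigenvalues_iff (hq : IntervalIntegrable q volume 0 1)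
    (hφ : IsSineFamily q φ φ') {l : ℂ} :
    l ∈ dirichletEigenvalues q ↔ ∃ r : ℝ, l = r ∧ φ r 1 = 0 := by
  constructor
  · rintro ⟨y, y', hy, hne, h0, h1⟩
    obtain ⟨r, rfl, c, hc, h2, -⟩ := (hy.isSol hq).exists_real_of_selfAdjoint hq hφ hne h0
      (by simp [h1])
    rw [h1] at h2
    exact ⟨r, rfl, by exact_mod_cast (mul_eq_zero.mp h2.symm).resolve_left hc⟩
  · rintro ⟨r, rfl, h⟩
    exact ⟨_, _, (hφ.isSol r).ofReal.isSolutionOn, hφ.exists_ne_zero_ofReal r,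
      by simp [hφ.zero], by simp [h]⟩

lemma mem_dirichletNeumannEigenvalues_iff (hq : IntervalIntegrable q volume 0 1)
    (hφ : IsSineFamily q φ φ') {l : ℂ} :
    l ∈ dirichletNeumannEigenvalues q ↔ ∃ r : ℝ, l = r ∧ φ' r 1 = 0 := by
  constructor
  · rintro ⟨y, y', hy, hne, h0, h1⟩
    obtain ⟨r, rfl, c, hc, -, h2⟩ := (hy.isSol hq).exists_real_of_selfAdjoint hq hφ hne h0
      (by simp [h1])
    rw [h1] at h2
    exact ⟨r, rfl, by exact_mod_cast (mul_eq_zero.mp h2.symm).resolve_left hc⟩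
  · rintro ⟨r, rfl, h⟩
    exact ⟨_, _, (hφ.isSol r).ofReal.isSolutionOn, hφ.exists_ne_zero_ofReal r,
      by simp [hφ.zero], by simp [h]⟩

/-- Under either boundary condition the boundary term of the quadratic form drops out, leaving `r ∫
φ² ≥ 0`. -/
lemma NoBoundState.nonneg_of_mul_eq_zero (hφ : IsSineFamily q φ φ') (hN : NoBoundState q φ φ')
    {r : ℝ} (h : φ r 1 * φ' r 1 = 0) : 0 ≤ r := by
  have h1 := hN.form_nonneg r _ _ (hφ.isSol r) (hφ.zero r)
  rw [h, zero_add] at h1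
  exact nonneg_of_mul_nonneg_left h1 (hφ.integral_sq_pos r)

lemma quantized_lt (hmono : StrictMonoOn (fun k => k - phase q φ φ' k) (Ici 0)) {p : ℕ → ℝ}
    (hp : ∀ n : ℕ, 1 ≤ n → 0 ≤ p n ∧ p n - phase q φ φ' (p n) = Real.pi / 2 * n) {m n : ℕ}
    (hm : 1 ≤ m) (hmn : m < n) : p m < p n := by
  rw [← hmono.lt_iff_lt (hp m hm).1 (hp n (hm.trans hmn.le)).1]
  rw [(hp m hm).2, (hp n (hm.trans hmn.le)).2]
  have : (m : ℝ) < n := by exact_mod_cast hmn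
  have := Real.pi_pos
  gcongr

/-- For `k > 0`, `φ (k²) 1 = 0` means that the angle is `mπ`, the multiple `2m` of `π/2`. Energy `0`
is excluded by `φ 0 1 > 0`, and `m ≥ 1` because the angle starts at a nonnegative value and
increases. -/
lemma isIncreasingList_dirichlet (hq : IntervalIntegrable q volume 0 1)
    (hφ : IsSineFamily q φ φ') (hN : NoBoundState q φ φ') {p : ℕ → ℝ}
    (hp : ∀ n : ℕ, 1 ≤ n → 0 ≤ p n ∧ p n - phase q φ φ' (p n) = Real.pi / 2 * n) :
    IsIncreasingList (fun n => p (2 * n) ^ 2) (dirichletEigenvalues q) := by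
  have hmono := strictMonoOn_sub_phase hq hφ hN
  have hpi := Real.pi_pos
  have h00 : 0 ≤ 0 - phase q φ φ' 0 ∧ 0 - phase q φ φ' 0 ≤ Real.pi / 2 := by
    rcases phase_zero_mem (q := q) (φ := φ) (φ' := φ') with ⟨h, -⟩ | ⟨h, -⟩ <;> rw [h] <;>
      constructor <;> linarith
  refine ⟨fun m n hm hmn => ?_, fun l => ?_⟩
  · exact pow_lt_pow_left₀ (quantized_lt hmono hp (by lia) (by lia)) (hp _ (by lia)).1 two_ne_zero
  rw [mem_dirichletEigenvalues_iff hq hφ]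
  constructor
  · rintro ⟨r, rfl, hr⟩
    have hr0 : 0 ≤ r := hN.nonneg_of_mul_eq_zero hφ (by rw [hr, zero_mul])
    obtain ⟨k, hk0, rfl⟩ : ∃ k : ℝ, 0 ≤ k ∧ k ^ 2 = r := ⟨√r, Real.sqrt_nonneg r, Real.sq_sqrt hr0⟩
    have hk : 0 < k := by
      refine lt_of_le_of_ne hk0 ?_
      rintro rfl
      have := hN.pos 1 (by simp)
      rw [zero_pow two_ne_zero] at hr
      linarith
    obtain ⟨ρ, hρ, -, hsin⟩ := hφ.exists_polar hq hk.ne'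
    rw [hr, mul_zero] at hsin
    obtain ⟨m, hm⟩ := Real.sin_eq_zero_iff.mp ((mul_eq_zero.mp hsin.symm).resolve_left hρ.ne')
    have hlt : 0 < (m : ℝ) * Real.pi := by
      rw [hm]
      exact h00.1.trans_lt (hmono (by simp) hk0 hk)
    have hm1 : 0 < m := by exact_mod_cast pos_of_mul_pos_left hlt hpi.le
    lift m to ℕ using hm1.le
    have hm1 : 1 ≤ m := by exact_mod_cast hm1
    refine ⟨m, hm1, ?_⟩
    have hp2 := hp (2 * m) (by lia)
    have : k = p (2 * m) := hmono.injOn hk0 hp2.1 (by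
      rw [hp2.2, ← hm]
      push_cast
      ring)
    rw [this]
  · rintro ⟨n, hn, rfl⟩
    refine ⟨p (2 * n) ^ 2, rfl, ?_⟩
    have hp2 := hp (2 * n) (by lia)
    have hn1 : (1 : ℝ) ≤ n := by exact_mod_cast hn
    push_cast at hp2
    have hk : p (2 * n) ≠ 0 := by
      intro h
      rw [h] at hp2
      nlinarith
    obtain ⟨ρ, hρ, -, hsin⟩ := hφ.exists_polar hq hk
    rw [hp2.2, show Real.pi / 2 * (2 * (n : ℝ)) = n * Real.pi by ring, Real.sin_nat_mul_pi,
      mul_zero] at hsin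
    exact (mul_eq_zero.mp hsin).resolve_left hk

/-- For `k > 0`, `φ' (k²) 1 = 0` means that the angle is an odd multiple of `π/2`. Energy `0` can
occur: it is an eigenvalue exactly in the resonant case, where the angle starts at `π/2` and `p 1 =
0`. -/
lemma isIncreasingList_dirichletNeumann (hq : IntervalIntegrable q volume 0 1)
    (hφ : IsSineFamily q φ φ') (hN : NoBoundState q φ φ') {p : ℕ → ℝ}
    (hp : ∀ n : ℕ, 1 ≤ n → 0 ≤ p n ∧ p n - phase q φ φ' (p n) = Real.pi / 2 * n) :
    IsIncreasingList (fun n => p (2 * n - 1) ^ 2) (dirichletNeumannEigenvalues q) := by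
  have hmono := strictMonoOn_sub_phase hq hφ hN
  have hpi := Real.pi_pos
  refine ⟨fun m n hm hmn => ?_, fun l => ?_⟩
  · exact pow_lt_pow_left₀ (quantized_lt hmono hp (by lia) (by lia)) (hp _ (by lia)).1 two_ne_zero
  rw [mem_dirichletNeumannEigenvalues_iff hq hφ]
  constructor
  · rintro ⟨r, rfl, hr⟩
    have hr0 : 0 ≤ r := hN.nonneg_of_mul_eq_zero hφ (by rw [hr, mul_zero])
    obtain ⟨k, hk0, rfl⟩ : ∃ k : ℝ, 0 ≤ k ∧ k ^ 2 = r := ⟨√r, Real.sqrt_nonneg r, Real.sq_sqrt hr0⟩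
    obtain ⟨m, hm⟩ : ∃ m : ℕ, k - phase q φ φ' k = Real.pi / 2 * (2 * m + 1) := by
      rcases eq_or_lt_of_le hk0 with rfl | hk
      · rw [zero_pow two_ne_zero] at hr
        exact ⟨0, by simp [phase, hr]⟩
      · obtain ⟨ρ, hρ, hcos, -⟩ := hφ.exists_polar hq hk.ne'
        rw [hr] at hcos
        obtain ⟨m, hm⟩ := Real.cos_eq_zero_iff.mp ((mul_eq_zero.mp hcos.symm).resolve_left hρ.ne')
        have hlt : 0 < (2 * (m : ℝ) + 1) * Real.pi / 2 := by
          rw [← hm]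
          refine lt_of_le_of_lt ?_ (hmono (by simp) hk0 hk)
          rcases phase_zero_mem (q := q) (φ := φ) (φ' := φ') with ⟨h, -⟩ | ⟨h, -⟩ <;> simp only <;>
            rw [h] <;> linarith
        have hm0 : 0 ≤ m := by
          have h2 : 0 < 2 * (m : ℝ) + 1 := by
            by_contra! hc
            nlinarith
          have h3 : 0 < 2 * m + 1 := by exact_mod_cast h2
          lia
        lift m to ℕ using hm0
        refine ⟨m, hm.trans ?_⟩
        push_cast
        ring
    refine ⟨m + 1, by lia, ?_⟩
    have hp2 := hp (2 * (m + 1) - 1) (by lia)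
    beta_reduce
    rw [show 2 * (m + 1) - 1 = 2 * m + 1 by lia] at hp2 ⊢
    have : k = p (2 * m + 1) := hmono.injOn hk0 hp2.1 (by
      rw [hp2.2, hm]
      push_cast
      ring)
    rw [this]
  · rintro ⟨n, hn, rfl⟩
    obtain ⟨m, rfl⟩ : ∃ m, n = m + 1 := ⟨n - 1, by lia⟩
    have hp2 := hp (2 * m + 1) (by lia)
    beta_reduce
    rw [show 2 * (m + 1) - 1 = 2 * m + 1 by lia]
    refine ⟨p (2 * m + 1) ^ 2, rfl, ?_⟩
    push_cast at hp2
    by_cases hk : p (2 * m + 1) = 0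
    · rw [hk] at hp2 ⊢
      rw [zero_pow two_ne_zero]
      rcases phase_zero_mem (q := q) (φ := φ) (φ' := φ') with ⟨h, -⟩ | ⟨-, h⟩
      · rw [h] at hp2
        have : 0 < Real.pi / 2 * (2 * (m : ℝ) + 1) := by positivity
        linarith
      · exact h
    · obtain ⟨ρ, hρ, hcos, -⟩ := hφ.exists_polar hq hk
      rw [hp2.2, show Real.pi / 2 * (2 * (m : ℝ) + 1) = m * Real.pi + Real.pi / 2 by ring,
        Real.cos_add_pi_div_two, Real.sin_nat_mul_pi, neg_zero, mul_zero] at hcos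
      exact hcos

end Spectrum

end HalfLine

namespace HalfLine

/-! ### Asymptotics of the quantized momenta -/

/-- Cosine coefficients of `q` on `[0, 1]`. -/
noncomputable def cosCoeff (q : ℝ → ℝ) (n : ℕ) : ℝ :=
  ∫ x in (0 : ℝ)..1, q x * Real.cos (Real.pi * n * x)

lemma cosCoeff_eq_re {q : ℝ → ℝ} (hq : IntervalIntegrable q volume 0 1) (n : ℕ) :
    cosCoeff q n =
      (∫ x in (0 : ℝ)..1, Complex.exp (-(Real.pi * n * x : ℝ) * Complex.I) * q x).re := by
  have hi : IntervalIntegrable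
      (fun x : ℝ => Complex.exp (-(Real.pi * n * x : ℝ) * Complex.I) * q x) volume 0 1 := by
    have hqc : IntervalIntegrable (fun t => (q t : ℂ)) volume 0 1 := by
      rw [intervalIntegrable_iff] at hq ⊢
      exact Integrable.ofReal hq
    exact hqc.continuousOn_mul (by fun_prop)
  have h := Complex.reCLM.intervalIntegral_comp_comm hi
  simp only [Complex.reCLM_apply] at h
  rw [← h]
  refine intervalIntegral.integral_congr fun x _ => ?_
  rw [Complex.re_mul_ofReal, ← Complex.ofReal_neg, Complex.exp_ofReal_mul_I_re, Real.cos_neg,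
    mul_comm]

lemma tendsto_cosCoeff {q : ℝ → ℝ} (hq : IntervalIntegrable q volume 0 1) :
    Tendsto (cosCoeff q) atTop (𝓝 0) := by
  have h1 := Real.tendsto_integral_exp_smul_cocompact (indicator (Ioc 0 1) fun x => (q x : ℂ))
  -- The Fourier kernel is `exp(-2πi w x)`, so the coefficient with `cos (πnx)` sits at frequency `w
  -- = n/2`.
  have h2 : Tendsto (fun n : ℕ => (n : ℝ) / 2) atTop (cocompact ℝ) :=
    (tendsto_natCast_atTop_atTop.atTop_div_const two_pos).mono_right atTop_le_cocompact
  have h3 := (Complex.continuous_re.tendsto 0).comp (h1.comp h2)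
  rw [Complex.zero_re] at h3
  refine h3.congr fun n => ?_
  rw [cosCoeff_eq_re hq]
  simp only [Function.comp_apply]
  congr 1
  rw [intervalIntegral.integral_of_le zero_le_one, ← integral_indicator measurableSet_Ioc]
  refine integral_congr_ae (Eventually.of_forall fun x => ?_)
  by_cases hx : x ∈ Ioc (0 : ℝ) 1
  · simp only [indicator_of_mem hx, Circle.smul_def, Real.fourierChar_apply, smul_eq_mul]
    congr 2
    push_cast
    ring
  · simp only [indicator_of_notMem hx, smul_zero]

/-- Extending `q` by zero to `(0, 2]` makes `cosCoeff q n` twice the real part of the `n`-th Fourier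
coefficient for period `2`; Parseval applies. -/
lemma summable_cosCoeff_sq {q : ℝ → ℝ} (hq : MemLp q 2 (volume.restrict (Ioc 0 1))) :
    Summable fun n : ℕ => cosCoeff q n ^ 2 := by
  have hqi : IntervalIntegrable q volume 0 1 := by
    rw [intervalIntegrable_iff, uIoc_of_le zero_le_one]
    exact hq.integrable one_le_two
  set f : ℝ → ℂ := indicator (Ioc 0 1) fun x => (q x : ℂ) with hf
  have hf2 : MemLp f 2 (volume.restrict (Ioc 0 2)) := by
    rw [hf, memLp_indicator_iff_restrict measurableSet_Ioc, Measure.restrict_restrict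
      measurableSet_Ioc, inter_eq_self_of_subset_left (Ioc_subset_Ioc_right one_le_two)]
    exact hq.ofReal
  have hs := (hasSum_sq_fourierCoeffOn two_pos hf2).summable
  -- The factor `4` is the square of the inverse of the normalization `1/2` for period `2`.
  have hs' := (hs.comp_injective Nat.cast_injective (f := fun i : ℤ => _)).mul_left 4
  refine Summable.of_nonneg_of_le (fun n => sq_nonneg _) (fun n => ?_) hs'
  have e : fourierCoeffOn two_pos f (n : ℤ) = (1 / 2 : ℝ) •
      ∫ x in (0 : ℝ)..1, Complex.exp (-(Real.pi * n * x : ℝ) * Complex.I) * q x := by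
    rw [fourierCoeffOn_eq_integral, sub_zero]
    congr 1
    rw [intervalIntegral.integral_of_le two_pos.le, intervalIntegral.integral_of_le zero_le_one,
      ← integral_indicator measurableSet_Ioc, ← integral_indicator measurableSet_Ioc]
    refine integral_congr_ae (Eventually.of_forall fun x => ?_)
    by_cases hx : x ∈ Ioc (0 : ℝ) 1
    · have hx2 : x ∈ Ioc (0 : ℝ) 2 := Ioc_subset_Ioc_right one_le_two hx
      simp only [indicator_of_mem hx, indicator_of_mem hx2, hf, fourier_coe_apply, smul_eq_mul]
      congr 2
      push_cast
      ring
    · by_cases hx2 : x ∈ Ioc (0 : ℝ) 2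
      · simp only [indicator_of_notMem hx, indicator_of_mem hx2, hf, smul_zero]
      · simp only [indicator_of_notMem hx, indicator_of_notMem hx2]
  simp only [Function.comp_apply]
  rw [e, cosCoeff_eq_re hqi, norm_smul, mul_pow]
  set z := ∫ x in (0 : ℝ)..1, Complex.exp (-(Real.pi * n * x : ℝ) * Complex.I) * q x
  have h1 : z.re ^ 2 ≤ ‖z‖ ^ 2 := by
    rw [← sq_abs z.re]
    exact pow_le_pow_left₀ (abs_nonneg _) (Complex.abs_re_le_norm z) 2
  norm_num
  linarith

/-! ### The phase at quantized momenta and the cosine coefficients of the potential. -/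

variable {q : ℝ → ℝ} {φ φ' : ℝ → ℝ → ℝ}

/-- In polar coordinates `k²` times the Prüfer density is `sin² θ`, and `2 sin² θ = 1 - cos 2θ`. -/
lemma IsSineFamily.two_mul_phase_eq (hq : IntervalIntegrable q volume 0 1)
    (hφ : IsSineFamily q φ φ') {k : ℝ} (hk : k ≠ 0) :
    2 * k * phase q φ φ' k = (∫ x in (0 : ℝ)..1, q x) -
      ∫ x in (0 : ℝ)..1, q x * Real.cos (2 * pruferAngle q (φ (k ^ 2)) (φ' (k ^ 2)) k x) := by
  have hsol := hφ.isSol (k ^ 2)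
  have hθc := (hsol.isPrimitive_pruferAngle hq hk (hφ.one _)).continuousOn
  rw [phase_of_ne hk, ← mul_assoc, ← intervalIntegral.integral_const_mul,
    ← intervalIntegral.integral_sub hq (hq.mul_continuousOn (by
      rw [uIcc_of_le zero_le_one]
      exact Real.continuous_cos.comp_continuousOn (continuousOn_const.mul hθc)))]
  refine intervalIntegral.integral_congr fun x hx => ?_
  rw [uIcc_of_le zero_le_one] at hx
  obtain ⟨r, hr, hcos, hsin⟩ := hsol.exists_prufer hq hk (hφ.zero _) (hφ.one _) hx
  set θ := pruferAngle q (φ (k ^ 2)) (φ' (k ^ 2)) k x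
  have hden : φ' (k ^ 2) x ^ 2 + k ^ 2 * φ (k ^ 2) x ^ 2 = r ^ 2 := by
    rw [← mul_pow, hcos, hsin]
    linear_combination r ^ 2 * Real.sin_sq_add_cos_sq θ
  have h1 : k ^ 2 * pruferDensity (φ (k ^ 2)) (φ' (k ^ 2)) k x = Real.sin θ ^ 2 := by
    rw [pruferDensity, hden, ← mul_div_assoc, ← mul_pow, hsin, mul_pow,
      mul_div_cancel_left₀ _ (pow_ne_zero 2 hr.ne')]
  have h2 := Real.cos_two_mul θ
  have h3 := Real.sin_sq_add_cos_sq θ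
  linear_combination (2 * q x) * h1 + q x * h2 + (2 * q x) * h3

/-- The quantization condition makes `πnx - 2θ(x)` equal to twice the partial phase integral minus
`2ξx`, hence at most `4Q/k` with `Q = ‖q‖₁`; the cosine is 1-Lipschitz. -/
lemma abs_two_mul_phase_sub_le (hq : IntervalIntegrable q volume 0 1)
    (hφ : IsSineFamily q φ φ') {k : ℝ} (hk : 0 < k) {n : ℕ}
    (hkn : k - phase q φ φ' k = Real.pi / 2 * n) :
    |2 * k * phase q φ φ' k - (∫ x in (0 : ℝ)..1, q x) + cosCoeff q n| ≤
      4 * (∫ t in (0 : ℝ)..1, |q t|) ^ 2 / k := by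
  have hsol := hφ.isSol (k ^ 2)
  have hθc := (hsol.isPrimitive_pruferAngle hq hk.ne' (hφ.one _)).continuousOn
  set Q := ∫ t in (0 : ℝ)..1, |q t|
  set θ := pruferAngle q (φ (k ^ 2)) (φ' (k ^ 2)) k with hθ
  have hQ0 : 0 ≤ Q := intervalIntegral.integral_nonneg zero_le_one fun t _ => abs_nonneg _
  rw [hφ.two_mul_phase_eq hq hk.ne', cosCoeff, show ∀ a b c : ℝ, a - b - a + c = c - b by
      intros; ring, ← intervalIntegral.integral_sub (hq.mul_continuousOn (by fun_prop))
      (hq.mul_continuousOn (by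
        rw [uIcc_of_le zero_le_one]
        exact Real.continuous_cos.comp_continuousOn (continuousOn_const.mul hθc)))]
  simp only [← mul_sub]
  refine (abs_integral_mul_le hq le_rfl zero_le_one le_rfl (B := 4 * Q / k) (by positivity)
    fun x hx => ?_).trans (le_of_eq (by ring))
  refine (Real.abs_cos_sub_cos_le _ _).trans ?_
  have h1 := abs_mul_integral_pruferDensity_le hq (φ (k ^ 2)) (φ' (k ^ 2)) hk.ne' hx
  have h2 := abs_phase_le (φ := φ) (φ' := φ') hq hk.ne'
  rw [abs_of_pos hk] at h1 h2
  have e : Real.pi * n * x - 2 * θ x = 2 * (k * ∫ t in (0 : ℝ)..x,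
      q t * pruferDensity (φ (k ^ 2)) (φ' (k ^ 2)) k t) - 2 * phase q φ φ' k * x := by
    simp only [hθ, pruferAngle]
    linear_combination (-2 * x) * hkn
  have h3 : |phase q φ φ' k * x| ≤ Q / k := by
    rw [abs_mul, abs_of_nonneg hx.1]
    exact (mul_le_of_le_one_right (abs_nonneg _) hx.2).trans h2
  rw [e, abs_le]
  rw [abs_le] at h1 h3
  have e4 : 4 * Q / k = 4 * (Q / k) := by ring
  rw [e4]
  constructor <;> linarith [h1.1, h1.2, h3.1, h3.2]

/-- By monotonicity it suffices to compare angles at `k = n`: for `n ≥ 2Q`, with `Q = ‖q‖₁`, `n -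
ξ(n) ≤ (3/2) n < πn/2`. -/
lemma eventually_le_quantized (hq : IntervalIntegrable q volume 0 1)
    (hmono : StrictMonoOn (fun k => k - phase q φ φ' k) (Ici 0)) {p : ℕ → ℝ}
    (hp : ∀ n : ℕ, 1 ≤ n → 0 ≤ p n ∧ p n - phase q φ φ' (p n) = Real.pi / 2 * n) :
    ∀ᶠ n : ℕ in atTop, (n : ℝ) ≤ p n := by
  set Q := ∫ t in (0 : ℝ)..1, |q t| with hQ
  filter_upwards [eventually_ge_atTop 1, tendsto_natCast_atTop_atTop.eventually_ge_atTop (2 * Q)]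
    with n hn hnQ
  have hn' : (1 : ℝ) ≤ n := by exact_mod_cast hn
  obtain ⟨h0, h1⟩ := hp n hn
  have hQ0 : 0 ≤ Q := intervalIntegral.integral_nonneg zero_le_one fun t _ => abs_nonneg _
  rw [← hmono.le_iff_le (show (n : ℝ) ∈ Ici 0 from mem_Ici.mpr n.cast_nonneg) h0]
  rw [h1]
  have h2 := abs_phase_le (φ := φ) (φ' := φ') hq (show (n : ℝ) ≠ 0 by positivity)
  have h3 := (abs_le.mp h2).1
  have h4 : Q / |(n : ℝ)| ≤ Q := div_le_self hQ0 (hn'.trans (le_abs_self _))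
  have h5 : Q / |(n : ℝ)| ≤ 1 / 2 * n := by linarith
  nlinarith [Real.pi_gt_three]

lemma eventually_abs_add_cosCoeff_le (hq : IntervalIntegrable q volume 0 1)
    (hφ : IsSineFamily q φ φ')
    (hmono : StrictMonoOn (fun k => k - phase q φ φ' k) (Ici 0)) {p : ℕ → ℝ}
    (hp : ∀ n : ℕ, 1 ≤ n → 0 ≤ p n ∧ p n - phase q φ φ' (p n) = Real.pi / 2 * n) :
    ∀ᶠ n : ℕ in atTop, |Real.pi * n * phase q φ φ' (p n) - (∫ x in (0 : ℝ)..1, q x) +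
      cosCoeff q n| ≤ 6 * (∫ t in (0 : ℝ)..1, |q t|) ^ 2 / n := by
  filter_upwards [eventually_ge_atTop 1, eventually_le_quantized hq hmono hp] with n hn hnp
  set Q := ∫ t in (0 : ℝ)..1, |q t|
  obtain ⟨h0, h1⟩ := hp n hn
  have hn' : (1 : ℝ) ≤ n := by exact_mod_cast hn
  have hk : 0 < p n := by linarith
  set k := p n
  have h2 := abs_two_mul_phase_sub_le hq hφ hk h1
  have h3 := abs_phase_le (φ := φ) (φ' := φ') hq hk.ne'
  rw [abs_of_pos hk] at h3
  have h4 : phase q φ φ' k ^ 2 ≤ Q ^ 2 / k := by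
    calc phase q φ φ' k ^ 2 = |phase q φ φ' k| ^ 2 := (sq_abs _).symm
      _ ≤ (Q / k) ^ 2 := by gcongr
      _ = Q ^ 2 / k / k := by field_simp
      _ ≤ Q ^ 2 / k := div_le_self (by positivity) (by linarith)
  have h5 : 6 * Q ^ 2 / k ≤ 6 * Q ^ 2 / n := by gcongr
  have h6 : 6 * Q ^ 2 / k = 4 * Q ^ 2 / k + 2 * (Q ^ 2 / k) := by ring
  -- Substituting `πn = 2(k - ξ)` replaces `2kξ` by `πnξ` at the cost of `2ξ² ≤ 2Q²/k`; together
  -- with the previous error `4Q²/k` this is the constant `6`.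
  have e : Real.pi * n * phase q φ φ' k = 2 * k * phase q φ φ' k - 2 * phase q φ φ' k ^ 2 := by
    linear_combination (-2 * phase q φ φ' k) * h1
  refine le_trans ?_ h5
  rw [h6, e, abs_le]
  have h7 := abs_le.mp h2
  have h8 := sq_nonneg (phase q φ φ' k)
  constructor <;> linarith [h7.1, h7.2]

/-! ### Transfer of decay and square summability across an `O(1/n)` error. -/

lemma tendsto_of_abs_add_le {σ c : ℕ → ℝ} {K : ℝ} (hc : Tendsto c atTop (𝓝 0))
    (h : ∀ᶠ n : ℕ in atTop, |σ n + c n| ≤ K / n) : Tendsto σ atTop (𝓝 0) := by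
  have h1 : Tendsto (fun n => σ n + c n) atTop (𝓝 0) :=
    squeeze_zero_norm' h (tendsto_const_div_atTop_nhds_zero_nat K)
  simpa using h1.sub hc

lemma summable_sq_of_abs_add_le {σ c : ℕ → ℝ} {K : ℝ} (hc : Summable fun n => c n ^ 2)
    (h : ∀ᶠ n : ℕ in atTop, |σ n + c n| ≤ K / n) : Summable fun n => σ n ^ 2 := by
  have hs : Summable fun n : ℕ => 2 * c n ^ 2 + 2 * K ^ 2 * (1 / (n : ℝ) ^ 2) :=
    (hc.mul_left 2).add ((Real.summable_one_div_nat_pow.mpr one_lt_two).mul_left _)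
  refine hs.of_norm_bounded_eventually_nat ?_
  filter_upwards [h] with n hn
  have h1 : (σ n + c n) ^ 2 ≤ K ^ 2 * (1 / (n : ℝ) ^ 2) := by
    calc (σ n + c n) ^ 2 = |σ n + c n| ^ 2 := (sq_abs _).symm
      _ ≤ (K / n) ^ 2 := by gcongr
      _ = _ := by ring
  rw [Real.norm_eq_abs, abs_of_nonneg (sq_nonneg _)]
  nlinarith [sq_nonneg (σ n + 2 * c n)]

end HalfLine

/-! ### Assembly of the proposition. -/

theorem proposition1p2 (q : ℝ → ℝ) (hq : q ∈ HalfLine.PotentialClassPlus 1) :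
    (∃! ξ : ℝ → ℝ, HalfLine.IsPhaseShift q ξ) ∧
    ∀ ξ : ℝ → ℝ, HalfLine.IsPhaseShift q ξ →
      StrictMonoOn (fun k => k - ξ k) (Ici 0) ∧
      (∀ k : ℝ, 0 ≤ k → ∃ d : ℝ, HasDerivWithinAt ξ d (Ici 0) k ∧ 0 < 1 - d) ∧
      (∀ n : ℕ, 1 ≤ n → ∃! k : ℝ, 0 ≤ k ∧ k - ξ k = Real.pi / 2 * n) ∧
      ∃ p σ : ℕ → ℝ,
        (∀ n : ℕ, 1 ≤ n →
          0 ≤ p n ∧ p n - ξ (p n) = Real.pi / 2 * n ∧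
          p n = Real.pi / 2 * n + ξ (p n) ∧
          ξ (p n) = ((∫ x in (0 : ℝ)..1, q x) + σ n) / (2 * (Real.pi / 2 * n))) ∧
        Tendsto σ atTop (𝓝 0) ∧
        HalfLine.IsIncreasingList (fun n => p (2 * n) ^ 2) (HalfLine.dirichletEigenvalues q) ∧
        HalfLine.IsIncreasingList (fun n => p (2 * n - 1) ^ 2) (HalfLine.dirichletNeumannEigenvalues q) ∧
        (q ∈ HalfLine.PotentialClassPlus 2 → Summable fun n : ℕ => σ (n + 1) ^ 2) := by
  have hqi := HalfLine.intervalIntegrable_of_mem hq.1 le_rfl zero_le_one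
  obtain ⟨φ, φ', hφ⟩ := HalfLine.exists_isSineFamily hqi
  have hN := HalfLine.noBoundState hq hφ
  have hphase := HalfLine.isPhaseShift_phase hq.1 hφ hN
  refine ⟨⟨_, hphase, fun η hη => hη.unique hphase⟩, fun ξ hξ => ?_⟩
  obtain rfl := hξ.unique hphase
  have hmono := HalfLine.strictMonoOn_sub_phase hqi hφ hN
  have hex : ∀ n : ℕ, 1 ≤ n →
      ∃! k : ℝ, 0 ≤ k ∧ k - HalfLine.phase q φ φ' k = Real.pi / 2 * n :=
    fun n hn => HalfLine.existsUnique_sub_phase_eq hqi hφ hN hn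
  refine ⟨hmono, fun k hk => HalfLine.exists_hasDerivWithinAt_phase hqi hφ hN hk, hex, ?_⟩
  -- The index `0` carries no condition, so an arbitrary value is supplied there to obtain a
  -- sequence on all of `ℕ`.
  have hex' : ∀ n : ℕ, ∃ k : ℝ, 1 ≤ n →
      0 ≤ k ∧ k - HalfLine.phase q φ φ' k = Real.pi / 2 * n := fun n => by
    by_cases hn : 1 ≤ n
    · obtain ⟨k, hk, -⟩ := hex n hn
      exact ⟨k, fun _ => hk⟩
    · exact ⟨0, fun h => absurd h hn⟩
  choose p hp using hex'
  have hbound := HalfLine.eventually_abs_add_cosCoeff_le hqi hφ hmono hp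
  -- The remainder `σ n` is defined by solving the claimed formula for it, so the formula is an
  -- identity and all content lies in `hbound`.
  refine ⟨p, fun n => Real.pi * n * HalfLine.phase q φ φ' (p n) - ∫ x in (0 : ℝ)..1, q x,
    fun n hn => ⟨(hp n hn).1, (hp n hn).2, by linarith [(hp n hn).2], ?_⟩,
    HalfLine.tendsto_of_abs_add_le (HalfLine.tendsto_cosCoeff hqi) hbound,
    HalfLine.isIncreasingList_dirichlet hqi hφ hN hp,
    HalfLine.isIncreasingList_dirichletNeumann hqi hφ hN hp, fun hq2 => ?_⟩
  · have hn' : (n : ℝ) ≠ 0 := by exact_mod_cast (by lia : n ≠ 0)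
    have := Real.pi_ne_zero
    field_simp
    ring
  · have hL2 : MemLp q 2 (volume.restrict (Ioc 0 1)) := hq2.1.1.mono_measure
      (Measure.restrict_mono (fun x hx => hx.1.le) le_rfl)
    exact (HalfLine.summable_sq_of_abs_add_le (HalfLine.summable_cosCoeff_sq hL2) hbound).comp_injective
      (add_left_injective 1)
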